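/- All manifolds are finite-dimensional, Hausdorff, second countable and without boundary, and all manifolds, maps and bundles are $C^\infty$. A control system $\mathbb C$ on a manifold $X$ is a locally trivial fibration $\pi_{\mathcal U}:\mathcal U\to X$ together with a smooth map $F:\mathcal U\to TX$ over $X$. A trajectory of $\mathbb C$ is a curve $x=\pi_{\mathcal U}\circ c:[a,b]\to X$ ($a<b$), where $c:[a,b]\to\mathcal U$ is measurable and essentially bounded, $x$ is absolutely continuous and $\dot x(t)=F(c(t))$ for almost every $t$. $\mathbb C$ is locally controllable at $x_0\in X$ if for every open neighbourhood $V$ of $x_0$ there is an open neighbourhood $W\subset V$ of $x_0$ such that any two points $x_1,x_2\in W$ are joined by a trajectory of the restriction $\mathbb C|_V$, i.e. by a trajectory of $\mathbb C$ contained in $V$. If $\pi:X\to Y$ is a fibration such that $\pi\circ\pi_{\mathcal U}$ is a fibration, then the quotient $\mathbb C/\pi$ is the control system $\mathcal U\xrightarrow{\pi_*\circ F}TY\to Y$ on $Y$. A distribution $D\subset TX$ (a vector subbundle) is regarded as the control system $\mathbb D: D\hookrightarrow TX\to X$. **Lemma 5.2.** Let $M$ be a manifold with a pseudo-product structure, i.e.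 a distribution $E\subset TM$ with a decomposition $E=L\oplus K$ into integrable subbundles, let $\mathbb E,\mathbb L,\mathbb K$ be the control systems of $E$, $L$, $K$, and let $z_0\in M$. Suppose that $E$ is bracket generating near $z_0$: for every $z$ in a neighbourhood of $z_0$, the iterated Lie brackets of local sections of $E$ near $z$ span $T_zM$. Then: 1. $\mathbb E$ is locally controllable at $z_0$. 2. Let $\pi_N:M\to N$ be a fibration with $\ker \pi_{N*}=K$. If $E\to M\xrightarrow{\pi_N}N$ is a fibration, then $\mathbb E/\pi_N$ is locally controllable at $\pi_N(z_0)$; if $L\to M\xrightarrow{\pi_N}N$ is a fibration, then $\mathbb L/\pi_N$ is locally controllable at $\pi_N(z_0)$. 3. Let $\pi_P:M\to P$ be a fibration with $\ker \pi_{P*}=L$. If $E\to M\xrightarrow{\pi_P}P$ is a fibration, then $\mathbb E/\pi_P$ is locally controllable at $\pi_P(z_0)$; if $K\to M\xrightarrow{\pi_P}P$ is a fibration, then $\mathbb K/\pi_P$ is locally controllable at $\pi_P(z_0)$. -/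

import Mathlib

open Set Filter Topology Bundle MeasureTheory
open scoped Manifold ContDiff

namespace PseudoProduct

set_option linter.unusedSectionVars false

noncomputable section

/-! ### Distributions and their total spaces -/

/-- `s` is a smooth frame over `O` of the family `D` of subspaces of the tangent spaces. -/
structure IsFrameOn {m r : ℕ} {M : Type*} [TopologicalSpace M]
    [ChartedSpace (EuclideanSpace ℝ (Fin m)) M] [IsManifold (𝓡 m) ∞ M]
    (D : ∀ z : M, Submodule ℝ (TangentSpace (𝓡 m) z))
    (s : Fin r → ∀ z : M, TangentSpace (𝓡 m) z) (O : Set M) : Prop where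
  smooth : ∀ i, ContMDiffOn (𝓡 m) (𝓡 m).tangent ∞
    (fun z => (⟨z, s i z⟩ : TangentBundle (𝓡 m) M)) O
  linearIndependent : ∀ z ∈ O, LinearIndependent ℝ (fun i => s i z)
  span_eq : ∀ z ∈ O, Submodule.span ℝ (range fun i => s i z) = D z

/-- A distribution on `M`, i.e. a smooth vector subbundle of `TM` of constant rank: a family of
subspaces of the tangent spaces which has a smooth frame near every point. -/
structure TangentDistribution (m : ℕ) (M : Type*) [TopologicalSpace M]
    [ChartedSpace (EuclideanSpace ℝ (Fin m)) M] [IsManifold (𝓡 m) ∞ M] where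
  rank : ℕ
  fiber : ∀ z : M, Submodule ℝ (TangentSpace (𝓡 m) z)
  exists_frame : ∀ z : M, ∃ O : Set M, IsOpen O ∧ z ∈ O ∧
    ∃ s : Fin rank → ∀ y : M, TangentSpace (𝓡 m) y, IsFrameOn fiber s O

section Bundle

variable {m : ℕ} {M : Type*} [TopologicalSpace M]
  [ChartedSpace (EuclideanSpace ℝ (Fin m)) M] [IsManifold (𝓡 m) ∞ M]

/-- The linear map `a ↦ ∑ aᵢ sᵢ(z)`. -/
def frameMap {r : ℕ} (s : Fin r → ∀ z : M, TangentSpace (𝓡 m) z) (z : M) :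
    EuclideanSpace ℝ (Fin r) →ₗ[ℝ] TangentSpace (𝓡 m) z :=
  Fintype.linearCombination ℝ (fun i => s i z) ∘ₗ
    (WithLp.linearEquiv 2 ℝ (Fin r → ℝ)).toLinearMap

theorem frameMap_apply {r : ℕ} (s : Fin r → ∀ z : M, TangentSpace (𝓡 m) z) (z : M)
    (a : EuclideanSpace ℝ (Fin r)) : frameMap s z a = ∑ i, a i • s i z := by
  simp [frameMap, Fintype.linearCombination_apply]

theorem IsFrameOn.injective {r : ℕ} {D : ∀ z : M, Submodule ℝ (TangentSpace (𝓡 m) z)}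
    {s : Fin r → ∀ z : M, TangentSpace (𝓡 m) z} {O : Set M} (h : IsFrameOn D s O)
    {z : M} (hz : z ∈ O) : Function.Injective (frameMap s z) := by
  have := (h.linearIndependent z hz).fintypeLinearCombination_injective
  exact this.comp (WithLp.linearEquiv 2 ℝ (Fin r → ℝ)).injective

theorem IsFrameOn.range_eq {r : ℕ} {D : ∀ z : M, Submodule ℝ (TangentSpace (𝓡 m) z)}
    {s : Fin r → ∀ z : M, TangentSpace (𝓡 m) z} {O : Set M} (h : IsFrameOn D s O)
    {z : M} (hz : z ∈ O) : LinearMap.range (frameMap s z) = D z := by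
  rw [← h.span_eq z hz, frameMap, LinearMap.range_comp_of_range_eq_top _ (LinearEquiv.range _)]
  exact Fintype.range_linearCombination ℝ (fun i => s i z)

/-- The coordinates on `D z` given by a frame. -/
def IsFrameOn.equiv {r : ℕ} {D : ∀ z : M, Submodule ℝ (TangentSpace (𝓡 m) z)}
    {s : Fin r → ∀ z : M, TangentSpace (𝓡 m) z} {O : Set M} (h : IsFrameOn D s O)
    {z : M} (hz : z ∈ O) : EuclideanSpace ℝ (Fin r) ≃ₗ[ℝ] D z :=
  (LinearEquiv.ofInjective (frameMap s z) (h.injective hz)).trans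
    (LinearEquiv.ofEq _ _ (h.range_eq hz))

theorem IsFrameOn.coe_equiv {r : ℕ} {D : ∀ z : M, Submodule ℝ (TangentSpace (𝓡 m) z)}
    {s : Fin r → ∀ z : M, TangentSpace (𝓡 m) z} {O : Set M} (h : IsFrameOn D s O)
    {z : M} (hz : z ∈ O) (a : EuclideanSpace ℝ (Fin r)) :
    ((h.equiv hz a : D z) : TangentSpace (𝓡 m) z) = frameMap s z a := rfl

namespace TangentDistribution

variable (D : TangentDistribution m M)

/-- The fibre over `z` of the total space of the distribution. -/
abbrev Fib (z : M) : Type := D.fiber z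

open Classical in
/-- The local trivialization of the total space of `D` given by a frame. -/
def framePretrivialization {s : Fin D.rank → ∀ z : M, TangentSpace (𝓡 m) z} {O : Set M}
    (hO : IsOpen O) (h : IsFrameOn D.fiber s O) :
    Pretrivialization (EuclideanSpace ℝ (Fin D.rank))
      (π (EuclideanSpace ℝ (Fin D.rank)) D.Fib) where
  toFun p := (p.1, if hz : p.1 ∈ O then (h.equiv hz).symm p.2 else 0)
  invFun p := ⟨p.1, if hz : p.1 ∈ O then h.equiv hz p.2 else 0⟩
  source := TotalSpace.proj ⁻¹' O
  target := O ×ˢ univ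
  map_source' := fun ⟨_, _⟩ hz => ⟨hz, mem_univ _⟩
  map_target' := fun ⟨_, _⟩ hz => hz.1
  left_inv' := fun ⟨z, v⟩ hz => by
    have hz' : z ∈ O := hz
    simp [hz']
  right_inv' := fun ⟨z, v⟩ hz => by
    have hz' : z ∈ O := hz.1
    simp [hz']
  open_target := hO.prod isOpen_univ
  baseSet := O
  open_baseSet := hO
  source_eq := rfl
  target_eq := rfl
  proj_toFun _ _ := rfl

open Classical in
theorem framePretrivialization_apply {s : Fin D.rank → ∀ z : M, TangentSpace (𝓡 m) z} {O : Set M}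
    (hO : IsOpen O) (h : IsFrameOn D.fiber s O) {z : M} (hz : z ∈ O) (v : D.Fib z) :
    D.framePretrivialization hO h ⟨z, v⟩ = (z, (h.equiv hz).symm v) := by
  change (z, dite (z ∈ O) (fun hz => (h.equiv hz).symm v) fun _ => 0) = _
  simp [hz]

open Classical in
theorem framePretrivialization_symm {s : Fin D.rank → ∀ z : M, TangentSpace (𝓡 m) z} {O : Set M}
    (hO : IsOpen O) (h : IsFrameOn D.fiber s O) {z : M} (hz : z ∈ O)
    (a : EuclideanSpace ℝ (Fin D.rank)) :
    (D.framePretrivialization hO h).symm z a = h.equiv hz a := by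
  rw [Pretrivialization.symm_apply _ hz]
  change (dite (z ∈ O) (fun hz => h.equiv hz a) fun _ => 0) = h.equiv hz a
  simp [hz]

open Classical in
/-- The change of coordinates between two frames. -/
def coordChange {s s' : Fin D.rank → ∀ z : M, TangentSpace (𝓡 m) z} {O O' : Set M}
    (h : IsFrameOn D.fiber s O) (h' : IsFrameOn D.fiber s' O') (z : M) :
    EuclideanSpace ℝ (Fin D.rank) →L[ℝ] EuclideanSpace ℝ (Fin D.rank) :=
  if hz : z ∈ O ∩ O' then
    LinearMap.toContinuousLinearMap ((h.equiv hz.1).trans (h'.equiv hz.2).symm).toLinearMap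
  else 0

theorem frameMap_coordChange {s s' : Fin D.rank → ∀ z : M, TangentSpace (𝓡 m) z} {O O' : Set M}
    (h : IsFrameOn D.fiber s O) (h' : IsFrameOn D.fiber s' O') {z : M} (hz : z ∈ O ∩ O')
    (a : EuclideanSpace ℝ (Fin D.rank)) :
    frameMap s' z (D.coordChange h h' z a) = frameMap s z a := by
  rw [← h'.coe_equiv hz.2, ← h.coe_equiv hz.1]
  simp [coordChange, hz]

/-- A frame read in the trivialization of the tangent bundle at `z₀`. -/
def frameMatrix {r : ℕ} (s : Fin r → ∀ z : M, TangentSpace (𝓡 m) z) (z₀ z : M) :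
    EuclideanSpace ℝ (Fin r) →L[ℝ] EuclideanSpace ℝ (Fin m) :=
  ∑ i, (EuclideanSpace.proj i : EuclideanSpace ℝ (Fin r) →L[ℝ] ℝ).smulRight
    (trivializationAt (EuclideanSpace ℝ (Fin m)) (TangentSpace (𝓡 m)) z₀ ⟨z, s i z⟩).2

theorem frameMatrix_apply {r : ℕ} (s : Fin r → ∀ z : M, TangentSpace (𝓡 m) z) {z₀ z : M}
    (hz : z ∈ (trivializationAt (EuclideanSpace ℝ (Fin m)) (TangentSpace (𝓡 m)) z₀).baseSet)
    (a : EuclideanSpace ℝ (Fin r)) :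
    frameMatrix s z₀ z a =
      (trivializationAt (EuclideanSpace ℝ (Fin m)) (TangentSpace (𝓡 m)) z₀).linearMapAt ℝ z
        (frameMap s z a) := by
  rw [frameMap_apply, map_sum]
  simp only [frameMatrix, sum_apply, map_smul]
  refine Finset.sum_congr rfl fun i _ => ?_
  rw [Trivialization.coe_linearMapAt_of_mem _ hz]
  rfl

theorem contMDiffOn_frameMatrix {r : ℕ} {D : ∀ z : M, Submodule ℝ (TangentSpace (𝓡 m) z)}
    {s : Fin r → ∀ z : M, TangentSpace (𝓡 m) z} {O : Set M} (hO : IsOpen O)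
    (h : IsFrameOn D s O) (z₀ : M) :
    ContMDiffOn (𝓡 m) 𝓘(ℝ, EuclideanSpace ℝ (Fin r) →L[ℝ] EuclideanSpace ℝ (Fin m)) ∞
      (frameMatrix s z₀)
      (O ∩ (trivializationAt (EuclideanSpace ℝ (Fin m)) (TangentSpace (𝓡 m)) z₀).baseSet) := by
  have key : ∀ i, ContMDiffOn (𝓡 m) 𝓘(ℝ, EuclideanSpace ℝ (Fin m)) ∞
      (fun z => (trivializationAt (EuclideanSpace ℝ (Fin m)) (TangentSpace (𝓡 m)) z₀
        ⟨z, s i z⟩).2)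
      (O ∩ (trivializationAt (EuclideanSpace ℝ (Fin m)) (TangentSpace (𝓡 m)) z₀).baseSet) := by
    intro i
    rw [← Trivialization.contMDiffOn_section_iff (IB := 𝓡 m) _
      (hO.inter (Trivialization.open_baseSet _)) inter_subset_right]
    exact (h.smooth i).mono inter_subset_left
  unfold frameMatrix
  refine contMDiffOn_finsetSum fun i _ => ?_
  have hL : ContDiff ℝ ∞ (fun v : EuclideanSpace ℝ (Fin m) =>
      (EuclideanSpace.proj i : EuclideanSpace ℝ (Fin r) →L[ℝ] ℝ).smulRight v) :=
    ContDiff.smulRight contDiff_const contDiff_id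
  exact hL.contMDiff.comp_contMDiffOn (key i)

theorem contMDiffOn_coordChange {s s' : Fin D.rank → ∀ z : M, TangentSpace (𝓡 m) z}
    {O O' : Set M} (hO : IsOpen O) (hO' : IsOpen O')
    (h : IsFrameOn D.fiber s O) (h' : IsFrameOn D.fiber s' O') :
    ContMDiffOn (𝓡 m)
      𝓘(ℝ, EuclideanSpace ℝ (Fin D.rank) →L[ℝ] EuclideanSpace ℝ (Fin D.rank)) ∞
      (D.coordChange h h') (O ∩ O') := by
  intro z₀ hz₀
  refine ContMDiffAt.contMDiffWithinAt ?_
  set B := (trivializationAt (EuclideanSpace ℝ (Fin m)) (TangentSpace (𝓡 m)) z₀).baseSet with hB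
  have hBo : IsOpen B := Trivialization.open_baseSet _
  have hzB : z₀ ∈ B := FiberBundle.mem_baseSet_trivializationAt' z₀
  -- a left inverse of the second frame at the base point
  have hinj : Function.Injective (frameMatrix s' z₀ z₀) := by
    intro a b hab
    rw [frameMatrix_apply s' hzB, frameMatrix_apply s' hzB] at hab
    refine h'.injective hz₀.2 ?_
    have := congrArg ((trivializationAt (EuclideanSpace ℝ (Fin m))
      (TangentSpace (𝓡 m)) z₀).symmₗ ℝ z₀) hab
    rwa [Trivialization.symmₗ_linearMapAt _ hzB, Trivialization.symmₗ_linearMapAt _ hzB] at this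
  obtain ⟨T₀, hT₀⟩ := LinearMap.exists_leftInverse_of_injective
    (frameMatrix s' z₀ z₀ : EuclideanSpace ℝ (Fin D.rank) →ₗ[ℝ] EuclideanSpace ℝ (Fin m))
    (LinearMap.ker_eq_bot.2 hinj)
  set T : EuclideanSpace ℝ (Fin m) →L[ℝ] EuclideanSpace ℝ (Fin D.rank) :=
    LinearMap.toContinuousLinearMap T₀ with hT
  have hTid : T.comp (frameMatrix s' z₀ z₀) = ContinuousLinearMap.id ℝ _ := by
    ext1 a
    exact LinearMap.congr_fun hT₀ a
  have hc : ContDiff ℝ ∞ (fun A : EuclideanSpace ℝ (Fin D.rank) →L[ℝ] EuclideanSpace ℝ (Fin m) =>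
      T.comp A) := ContDiff.clm_comp contDiff_const contDiff_id
  have hA : ContMDiffAt (𝓡 m)
      𝓘(ℝ, EuclideanSpace ℝ (Fin D.rank) →L[ℝ] EuclideanSpace ℝ (Fin D.rank)) ∞
      (fun z => T.comp (frameMatrix s z₀ z)) z₀ :=
    hc.contMDiff.contMDiffAt.comp z₀ ((contMDiffOn_frameMatrix hO h z₀).contMDiffAt
      ((hO.inter hBo).mem_nhds ⟨hz₀.1, hzB⟩))
  have hA' : ContMDiffAt (𝓡 m)
      𝓘(ℝ, EuclideanSpace ℝ (Fin D.rank) →L[ℝ] EuclideanSpace ℝ (Fin D.rank)) ∞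
      (fun z => T.comp (frameMatrix s' z₀ z)) z₀ :=
    hc.contMDiff.contMDiffAt.comp z₀ ((contMDiffOn_frameMatrix hO' h' z₀).contMDiffAt
      ((hO'.inter hBo).mem_nhds ⟨hz₀.2, hzB⟩))
  have hInv : ContMDiffAt (𝓡 m)
      𝓘(ℝ, EuclideanSpace ℝ (Fin D.rank) →L[ℝ] EuclideanSpace ℝ (Fin D.rank)) ∞
      (fun z => ContinuousLinearMap.inverse (T.comp (frameMatrix s' z₀ z))) z₀ := by
    have h1 : ContDiffAt ℝ ∞ ContinuousLinearMap.inverse (T.comp (frameMatrix s' z₀ z₀)) := by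
      rw [hTid]
      exact contDiffAt_map_inverse (ContinuousLinearEquiv.refl ℝ _)
    exact h1.contMDiffAt.comp z₀ hA'
  have hFin : ContMDiffAt (𝓡 m) 
      𝓘(ℝ, EuclideanSpace ℝ (Fin D.rank) →L[ℝ] EuclideanSpace ℝ (Fin D.rank)) ∞
      (fun z => (ContinuousLinearMap.inverse (T.comp (frameMatrix s' z₀ z))).comp
      (T.comp (frameMatrix s z₀ z))) z₀ := hInv.clm_comp hA
  refine hFin.congr_of_eventuallyEq ?_
  have hunit : ∀ᶠ z in 𝓝 z₀, IsUnit (T.comp (frameMatrix s' z₀ z)) := by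
    refine hA'.continuousAt.eventually (Units.isOpen.mem_nhds ?_)
    change IsUnit (T.comp (frameMatrix s' z₀ z₀))
    rw [hTid]
    exact isUnit_one
  filter_upwards [hunit, (hO.inter hBo).mem_nhds ⟨hz₀.1, hzB⟩, hO'.mem_nhds hz₀.2]
    with z hu hz hz'
  obtain ⟨u, hu⟩ := hu
  obtain ⟨e, he⟩ : ∃ e : EuclideanSpace ℝ (Fin D.rank) ≃L[ℝ] EuclideanSpace ℝ (Fin D.rank),
      (e : EuclideanSpace ℝ (Fin D.rank) →L[ℝ] EuclideanSpace ℝ (Fin D.rank)) =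
        T.comp (frameMatrix s' z₀ z) := ⟨ContinuousLinearEquiv.ofUnit u, hu⟩
  have hcomp : (T.comp (frameMatrix s' z₀ z)).comp (D.coordChange h h' z) =
      T.comp (frameMatrix s z₀ z) := by
    ext1 a
    simp only [ContinuousLinearMap.comp_apply]
    rw [frameMatrix_apply s' hz.2, frameMatrix_apply s hz.2,
      D.frameMap_coordChange h h' ⟨hz.1, hz'⟩]
  rw [← hcomp, ← he, ContinuousLinearMap.inverse_equiv]
  ext1 a
  simp

/-- The vector bundle structure of the total space of a distribution. -/
def prebundle : VectorPrebundle ℝ (EuclideanSpace ℝ (Fin D.rank)) D.Fib where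
  pretrivializationAtlas := {e | ∃ (O : Set M) (s : Fin D.rank → ∀ z : M, TangentSpace (𝓡 m) z)
    (hO : IsOpen O) (h : IsFrameOn D.fiber s O), e = D.framePretrivialization hO h}
  pretrivialization_linear' := by
    rintro _ ⟨O, s, hO, h, rfl⟩
    refine ⟨fun z hz => ?_⟩
    have : (fun v : D.Fib z => (D.framePretrivialization hO h ⟨z, v⟩).2) =
        (h.equiv hz).symm := by
      funext v
      rw [D.framePretrivialization_apply hO h hz]
    rw [this]
    exact LinearMap.isLinear (h.equiv hz).symm.toLinearMap
  pretrivializationAt z := D.framePretrivialization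
    (D.exists_frame z).choose_spec.1 (D.exists_frame z).choose_spec.2.2.choose_spec
  mem_base_pretrivializationAt z := (D.exists_frame z).choose_spec.2.1
  pretrivialization_mem_atlas z := ⟨_, _, _, _, rfl⟩
  exists_coordChange := by
    rintro _ ⟨O, s, hO, h, rfl⟩ _ ⟨O', s', hO', h', rfl⟩
    refine ⟨D.coordChange h h', (D.contMDiffOn_coordChange hO hO' h h').continuousOn, ?_⟩
    intro z hz a
    rw [D.framePretrivialization_symm hO h hz.1, D.framePretrivialization_apply hO' h' hz.2]
    have hz' : z ∈ O ∩ O' := hz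
    simp [coordChange, hz']
  totalSpaceMk_isInducing := by
    intro z
    have hz := (D.exists_frame z).choose_spec.2.1
    set h := (D.exists_frame z).choose_spec.2.2.choose_spec
    have : T2Space (TangentSpace (𝓡 m) z) :=
      inferInstanceAs (T2Space (EuclideanSpace ℝ (Fin m)))
    have : FiniteDimensional ℝ (TangentSpace (𝓡 m) z) :=
      inferInstanceAs (FiniteDimensional ℝ (EuclideanSpace ℝ (Fin m)))
    have : IsInducing fun v : D.Fib z =>
        (z, (h.equiv hz).symm.toContinuousLinearEquiv v) :=
      isInducing_const_prod.mpr
        ((h.equiv hz).symm.toContinuousLinearEquiv).toHomeomorph.isInducing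
    convert this using 1
    ext1 v
    exact D.framePretrivialization_apply _ h hz v

instance : D.prebundle.IsContMDiff (𝓡 m) ∞ where
  exists_contMDiffCoordChange := by
    rintro _ ⟨O, s, hO, h, rfl⟩ _ ⟨O', s', hO', h', rfl⟩
    refine ⟨D.coordChange h h', D.contMDiffOn_coordChange hO hO' h h', ?_⟩
    intro z hz a
    rw [D.framePretrivialization_symm hO h hz.1, D.framePretrivialization_apply hO' h' hz.2]
    have hz' : z ∈ O ∩ O' := hz
    simp [coordChange, hz']

/-- The total space of a distribution. -/
abbrev Total : Type _ := TotalSpace (EuclideanSpace ℝ (Fin D.rank)) D.Fib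

instance : TopologicalSpace D.Total := D.prebundle.totalSpaceTopology

instance : FiberBundle (EuclideanSpace ℝ (Fin D.rank)) D.Fib := D.prebundle.toFiberBundle

instance : VectorBundle ℝ (EuclideanSpace ℝ (Fin D.rank)) D.Fib := D.prebundle.toVectorBundle

instance : ContMDiffVectorBundle ∞ (EuclideanSpace ℝ (Fin D.rank)) D.Fib (𝓡 m) :=
  D.prebundle.contMDiffVectorBundle (𝓡 m)

/-- The inclusion of a distribution in the tangent bundle, as a map of total spaces. -/
def incl (v : D.Total) : TangentBundle (𝓡 m) M := ⟨v.proj, (v.snd : TangentSpace (𝓡 m) v.proj)⟩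

theorem contMDiff_incl :
    ContMDiff ((𝓡 m).prod (𝓡 D.rank)) (𝓡 m).tangent ∞ D.incl := by
  intro v₀
  rw [contMDiffAt_totalSpace]
  refine ⟨(contMDiff_proj D.Fib).contMDiffAt, ?_⟩
  set z₀ := v₀.proj with hz₀
  set s := (D.exists_frame z₀).choose_spec.2.2.choose
  set O := (D.exists_frame z₀).choose
  have hO : IsOpen O := (D.exists_frame z₀).choose_spec.1
  have hzO : z₀ ∈ O := (D.exists_frame z₀).choose_spec.2.1
  have h : IsFrameOn D.fiber s O := (D.exists_frame z₀).choose_spec.2.2.choose_spec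
  set B := (trivializationAt (EuclideanSpace ℝ (Fin m)) (TangentSpace (𝓡 m)) z₀).baseSet
  have hB : IsOpen B := Trivialization.open_baseSet _
  have hzB : z₀ ∈ B := FiberBundle.mem_baseSet_trivializationAt' z₀
  let e := trivializationAt (EuclideanSpace ℝ (Fin D.rank)) D.Fib z₀
  have he : ContMDiffAt ((𝓡 m).prod (𝓡 D.rank)) ((𝓡 m).prod (𝓡 D.rank)) ∞ e v₀ :=
    e.contMDiffOn.contMDiffAt (e.open_source.mem_nhds
      (e.mem_source.2 (FiberBundle.mem_baseSet_trivializationAt' z₀)))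
  have hA : ContMDiffAt ((𝓡 m).prod (𝓡 D.rank))
      𝓘(ℝ, EuclideanSpace ℝ (Fin D.rank) →L[ℝ] EuclideanSpace ℝ (Fin m)) ∞
      (fun v : D.Total => frameMatrix s z₀ v.proj) v₀ :=
    ContMDiffAt.comp (g := frameMatrix s z₀) (f := fun v : D.Total => v.proj) v₀
      ((contMDiffOn_frameMatrix hO h z₀).contMDiffAt ((hO.inter hB).mem_nhds ⟨hzO, hzB⟩))
      (contMDiff_proj D.Fib).contMDiffAt
  have hF : ContMDiffAt ((𝓡 m).prod (𝓡 D.rank)) (𝓡 m) ∞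
      (fun v : D.Total => frameMatrix s z₀ v.proj (e v).2) v₀ :=
    hA.clm_apply (contMDiffAt_snd.comp v₀ he)
  refine hF.congr_of_eventuallyEq ?_
  have hcont : ContinuousAt (TotalSpace.proj : D.Total → M) v₀ :=
    (contMDiff_proj (n := ∞) (IB := 𝓡 m) D.Fib).continuous.continuousAt
  filter_upwards [hcont.preimage_mem_nhds ((hO.inter hB).mem_nhds ⟨hzO, hzB⟩)]
  rintro ⟨z, v⟩ ⟨hz, hz'⟩
  have h1 : (e ⟨z, v⟩).2 = (h.equiv hz).symm v :=
    congrArg Prod.snd (D.framePretrivialization_apply hO h hz v)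
  change _ = frameMatrix s z₀ z (e ⟨z, v⟩).2
  rw [h1, frameMatrix_apply s hz', ← h.coe_equiv hz, LinearEquiv.apply_symm_apply,
    Trivialization.coe_linearMapAt_of_mem _ hz']
  rfl

end TangentDistribution

end Bundle

/-! ### Smooth fibrations and control systems -/

section Control

variable {EU HU U E H M E' H' N : Type*}
  [NormedAddCommGroup EU] [NormedSpace ℝ EU] [TopologicalSpace HU]
  [NormedAddCommGroup E] [NormedSpace ℝ E] [TopologicalSpace H]
  [NormedAddCommGroup E'] [NormedSpace ℝ E'] [TopologicalSpace H']
  [TopologicalSpace U] [ChartedSpace HU U]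
  [TopologicalSpace M] [ChartedSpace H M]
  [TopologicalSpace N] [ChartedSpace H' N]

/-- A smooth locally trivial fibration: a smooth map `p : U → M` such that every point of `M` has
an open neighbourhood `V` (the base set of `e`) with a diffeomorphism `e` from `p ⁻¹' V` onto
`V × F` over `V`, for a smooth finite-dimensional manifold `F`. (Fibres of a map from a
second-countable Hausdorff manifold have at most the cardinality of the continuum, so it is no
restriction to take `F` in `Type`.) -/
structure IsFibration (IU : ModelWithCorners ℝ EU HU) (I : ModelWithCorners ℝ E H)
    (p : U → M) : Prop where
  contMDiff : ContMDiff IU I ∞ p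
  locallyTrivial : ∀ x : M, ∃ (k : ℕ) (F : Type) (_ : TopologicalSpace F)
    (_ : ChartedSpace (EuclideanSpace ℝ (Fin k)) F) (_ : IsManifold (𝓡 k) ∞ F)
    (e : Trivialization F p), x ∈ e.baseSet ∧
      ContMDiffOn IU (I.prod (𝓡 k)) ∞ e e.source ∧
      ContMDiffOn (I.prod (𝓡 k)) IU ∞ e.toOpenPartialHomeomorph.symm e.target

/-- A control system `U → TM → M`: a fibration `proj : U → M` and a smooth map `F : U → TM` over
`M`. The map `F` is given by its vector component `vel u ∈ T_{proj u} M`, so that the triangle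
commutes by construction. -/
structure ControlSystem (IU : ModelWithCorners ℝ EU HU) (U : Type*) [TopologicalSpace U]
    [ChartedSpace HU U] (I : ModelWithCorners ℝ E H) (M : Type*) [TopologicalSpace M]
    [ChartedSpace H M] [IsManifold I ∞ M] where
  proj : U → M
  isFibration : IsFibration IU I proj
  vel : ∀ u : U, TangentSpace I (proj u)
  contMDiff_vel : ContMDiff IU I.tangent ∞ fun u => (⟨proj u, vel u⟩ : TangentBundle I M)

/-- An absolutely continuous curve `x : [a, b] → M` in a manifold: it is continuous, and absolutely
continuous in charts on each compact interval which it maps into the domain of a chart. -/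
structure IsAbsolutelyContinuousCurve (I : ModelWithCorners ℝ E H) (x : ℝ → M) (a b : ℝ) :
    Prop where
  continuousOn : ContinuousOn x (Icc a b)
  absolutelyContinuous : ∀ (q : M) (c d : ℝ), a ≤ c → c ≤ d → d ≤ b →
    MapsTo x (Icc c d) (chartAt H q).source →
    AbsolutelyContinuousOnInterval (fun t => extChartAt I q (x t)) c d

namespace ControlSystem

variable {IU : ModelWithCorners ℝ EU HU} {I : ModelWithCorners ℝ E H}
  {J : ModelWithCorners ℝ E' H'} [IsManifold I ∞ M] [IsManifold J ∞ N]

/-- `c : [a, b] → U` is an admissible control: it is (Lebesgue) measurable and essentially bounded,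
its projection `x = proj ∘ c` is absolutely continuous, and `x'(t) = F (c t)` for almost every
`t ∈ [a, b]`. A map into a manifold is essentially bounded if it has almost all of its values in
some compact set. Values of `c` outside `[a, b]` play no role. -/
structure IsAdmissible (C : ControlSystem IU U I M) (c : ℝ → U) (a b : ℝ) : Prop where
  aemeasurable : @AEMeasurable ℝ U (borel U) _ c (volume.restrict (Icc a b))
  essentiallyBounded : ∃ Q : Set U, IsCompact Q ∧ ∀ᵐ t ∂(volume.restrict (Icc a b)), c t ∈ Q
  absolutelyContinuous : IsAbsolutelyContinuousCurve I (fun t => C.proj (c t)) a b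
  hasMFDerivAt : ∀ᵐ t ∂(volume.restrict (Icc a b)),
    HasMFDerivAt 𝓘(ℝ, ℝ) I (fun t => C.proj (c t)) t
      ((1 : ℝ →L[ℝ] ℝ).smulRight (C.vel (c t)))

/-- `x : [a, b] → M` is a trajectory of `C`: the projection of an admissible control. -/
def IsTrajectory (C : ControlSystem IU U I M) (x : ℝ → M) (a b : ℝ) : Prop :=
  ∃ c : ℝ → U, C.IsAdmissible c a b ∧ ∀ t ∈ Icc a b, x t = C.proj (c t)

/-- `z₁` and `z₂` are joined by a trajectory of the restriction of `C` to the open set `V`, that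
is, by a trajectory of `C` that stays in `V`. (Such a trajectory has compact image in `V`, so the
control is also essentially bounded in `proj ⁻¹' V`.) -/
def JoinedIn (C : ControlSystem IU U I M) (V : Set M) (z₁ z₂ : M) : Prop :=
  ∃ (a b : ℝ) (x : ℝ → M), a < b ∧ C.IsTrajectory x a b ∧ (∀ t ∈ Icc a b, x t ∈ V) ∧
    x a = z₁ ∧ x b = z₂

/-- Local controllability at `z₀`. -/
def LocallyControllableAt (C : ControlSystem IU U I M) (z₀ : M) : Prop :=
  ∀ V : Set M, IsOpen V → z₀ ∈ V →
    ∃ W : Set M, IsOpen W ∧ z₀ ∈ W ∧ W ⊆ V ∧ ∀ z₁ ∈ W, ∀ z₂ ∈ W, C.JoinedIn V z₁ z₂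

/-- The quotient of a control system on `M` by a fibration `pr : M → N`, the composition
`U → M → N` being supposed a fibration as well. -/
def quotient (C : ControlSystem IU U I M) (pr : M → N) (hpr : IsFibration I J pr)
    (hcomp : IsFibration IU J (pr ∘ C.proj)) : ControlSystem IU U J N where
  proj := pr ∘ C.proj
  isFibration := hcomp
  vel u := mfderiv I J pr (C.proj u) (C.vel u)
  contMDiff_vel := (hpr.contMDiff.contMDiff_tangentMap (m := ∞) (by simp)).comp C.contMDiff_vel

end ControlSystem

end Control

/-! ### Pseudo-product structures -/

section PseudoProductStructure

variable {m : ℕ} {M : Type*} [TopologicalSpace M]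
  [ChartedSpace (EuclideanSpace ℝ (Fin m)) M] [IsManifold (𝓡 m) ∞ M]

namespace TangentDistribution

/-- The control system `D → TM → M` of a distribution `D`. -/
def controlSystem (D : TangentDistribution m M) :
    ControlSystem ((𝓡 m).prod (𝓡 D.rank)) D.Total (𝓡 m) M where
  proj := TotalSpace.proj
  isFibration :=
    { contMDiff := contMDiff_proj D.Fib
      locallyTrivial := fun x =>
        ⟨D.rank, EuclideanSpace ℝ (Fin D.rank), inferInstance, inferInstance, inferInstance,
          trivializationAt (EuclideanSpace ℝ (Fin D.rank)) D.Fib x,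
          FiberBundle.mem_baseSet_trivializationAt' x,
          Trivialization.contMDiffOn _, Trivialization.contMDiffOn_symm _⟩ }
  vel v := v.snd
  contMDiff_vel := D.contMDiff_incl

/-- `D` is integrable: locally it is tangent to the fibres of a submersion. -/
def IsIntegrable (D : TangentDistribution m M) : Prop :=
  ∀ z : M, ∃ (O : Set M) (q : ℕ) (f : M → EuclideanSpace ℝ (Fin q)), IsOpen O ∧ z ∈ O ∧
    ContMDiffOn (𝓡 m) (𝓡 q) ∞ f O ∧
    ∀ y ∈ O, Function.Surjective (mfderiv (𝓡 m) (𝓡 q) f y) ∧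
      (mfderiv (𝓡 m) (𝓡 q) f y).ker = D.fiber y

/-- `X` is a smooth section of `D` over the open set `O`. -/
structure IsSectionOn (D : TangentDistribution m M) (X : ∀ z : M, TangentSpace (𝓡 m) z)
    (O : Set M) : Prop where
  smooth : ContMDiffOn (𝓡 m) (𝓡 m).tangent ∞
    (fun z => (⟨z, X z⟩ : TangentBundle (𝓡 m) M)) O
  mem : ∀ z ∈ O, X z ∈ D.fiber z

/-- The iterated Lie brackets `X`, `[X₁, X]`, `[X₂, [X₁, X]]`, ... of smooth sections of `D` over
the open set `O`. (Only the values on `O` matter.) -/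
inductive IsIteratedBracketOn (D : TangentDistribution m M) (O : Set M) :
    (∀ z : M, TangentSpace (𝓡 m) z) → Prop
  | of_section (X : ∀ z : M, TangentSpace (𝓡 m) z) (hX : D.IsSectionOn X O) :
      IsIteratedBracketOn D O X
  | bracket (X Y : ∀ z : M, TangentSpace (𝓡 m) z) (hX : D.IsSectionOn X O)
      (hY : IsIteratedBracketOn D O Y) :
      IsIteratedBracketOn D O (VectorField.mlieBracket (𝓡 m) X Y)

/-- `D` is bracket generating at `z`: the iterated Lie brackets of local sections of `D` near `z`
span `T_z M`. -/
def IsBracketGeneratingAt (D : TangentDistribution m M) (z : M) : Prop :=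
  Submodule.span ℝ {v : TangentSpace (𝓡 m) z | ∃ (O : Set M) (X : ∀ y : M, TangentSpace (𝓡 m) y),
    IsOpen O ∧ z ∈ O ∧ D.IsIteratedBracketOn O X ∧ X z = v} = ⊤

/-- `D` is bracket generating near `z₀`. -/
def IsBracketGeneratingNear (D : TangentDistribution m M) (z₀ : M) : Prop :=
  ∀ᶠ z in 𝓝 z₀, D.IsBracketGeneratingAt z

end TangentDistribution

/-- A pseudo-product structure on `M`: a distribution `E` with a decomposition `E = L ⊕ K` into
integrable subbundles. -/
structure PseudoProductStructure (m : ℕ) (M : Type*) [TopologicalSpace M]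
    [ChartedSpace (EuclideanSpace ℝ (Fin m)) M] [IsManifold (𝓡 m) ∞ M] where
  E : TangentDistribution m M
  L : TangentDistribution m M
  K : TangentDistribution m M
  sup_eq : ∀ z, L.fiber z ⊔ K.fiber z = E.fiber z
  disjoint : ∀ z, Disjoint (L.fiber z) (K.fiber z)
  integrable_L : L.IsIntegrable
  integrable_K : K.IsIntegrable

end PseudoProductStructure

end

end PseudoProduct

open Set Filter Topology Bundle MeasureTheory
open scoped Manifold ContDiff

namespace PseudoProduct

set_option linter.unusedSectionVars false

/-! Near `z₀`, read in a chart, `L` and `K` are the kernels of the differentials of two submersions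
`fL` and `fK`. Call two points equivalent if a finite chain of points of a small open set joins
them, consecutive points having the same value of `fL` or of `fK`. Each step of a chain is realised
by a smooth curve inside a leaf and inside `V`, so everything reduces to one claim: the class of the
base point is a neighbourhood of it.

This is a Chow–Rashevskii theorem (`eventually_rel_of_bracketGenerating`), proved by a maximal
dimension argument. Among the immersed pieces contained in the class choose one of largest
dimension. Sliding points along the leaves realises every vector of `L` and of `K` as the initial
velocity of a family of local maps preserving classes. If such a vector were transversal to the
piece at some point, sliding the piece would produce one of dimension one higher
(`IsImmersionInClass.prod`). Hence the piece is tangent to `E` all along, therefore to the iterated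
brackets of sections of `E` (`IsBracketOn.mem_range`), therefore to everything, and it is open. So
the class contains a neighbourhood of one of its points. Submersions are open maps, so chains can be
perturbed, and this neighbourhood is carried back to the base point.

For the quotients, each joining curve is recorded together with the `L`-component of its velocity
(`SmoothlyJoinedIn`). The full velocity is a control for `E`. After projection along `K` the
velocity and its `L`-component coincide, so the `L`-component is a control for the quotient of `L`,
although the curve upstairs need not be tangent to `L`. Fibrations are open, so the neighbourhood
upstairs projects to one downstairs; the statement over `P` follows by exchanging `L` and `K`. -/

noncomputable section

/-! ### Chow–Rashevskii by immersions of maximal dimension -/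

section LocalChow

variable {E K : Type*} [NormedAddCommGroup E] [NormedSpace ℝ E]
  [NormedAddCommGroup K] [NormedSpace ℝ K]

/-- Lie brackets of vector fields which are related by `G` are related by `G`. -/
theorem fderiv_lieBracket_of_related {G : K → E} {X Y : E → E} {η θ : K → K} {p : K}
    (hG : ContDiffAt ℝ 2 G p) (hX : DifferentiableAt ℝ X (G p)) (hY : DifferentiableAt ℝ Y (G p))
    (hη : DifferentiableAt ℝ η p) (hθ : DifferentiableAt ℝ θ p)
    (hGX : ∀ᶠ u in 𝓝 p, fderiv ℝ G u (η u) = X (G u))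
    (hGY : ∀ᶠ u in 𝓝 p, fderiv ℝ G u (θ u) = Y (G u)) :
    fderiv ℝ G p (VectorField.lieBracket ℝ η θ p) = VectorField.lieBracket ℝ X Y (G p) := by
  have hGd : DifferentiableAt ℝ G p := hG.differentiableAt (by simp)
  -- Differentiate the relation itself. In the difference of the two resulting identities the second
  -- derivatives of `G` cancel by symmetry.
  have aux : ∀ {Z : E → E} {ζ : K → K}, DifferentiableAt ℝ Z (G p) →
      (∀ᶠ u in 𝓝 p, fderiv ℝ G u (ζ u) = Z (G u)) →
      fderiv ℝ (fun u => fderiv ℝ G u (ζ u)) p = (fderiv ℝ Z (G p)).comp (fderiv ℝ G p) := by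
    intro Z ζ hZ h
    rw [Filter.EventuallyEq.fderiv_eq (f₁ := fun u => fderiv ℝ G u (ζ u))
      (f := Z ∘ G) h, fderiv_comp p hZ hGd]
  rw [VectorField.fderiv_apply_lieBracket hG (by simp) hθ hη, aux hX hGX, aux hY hGY,
    VectorField.lieBracket_eq]
  simp [hGX.self_of_nhds, hGY.self_of_nhds]

/-- The iterated Lie brackets, over the open set `Ω`, of the smooth vector fields with values in
a family `D` of subspaces of a vector space. -/
inductive IsBracketOn (D : E → Submodule ℝ E) (Ω : Set E) : (E → E) → Prop
  | of_section (X : E → E) (hX : ContDiffOn ℝ ∞ X Ω) (hD : ∀ x ∈ Ω, X x ∈ D x) :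
      IsBracketOn D Ω X
  | bracket (X Y : E → E) (hX : ContDiffOn ℝ ∞ X Ω) (hD : ∀ x ∈ Ω, X x ∈ D x)
      (hY : IsBracketOn D Ω Y) : IsBracketOn D Ω (VectorField.lieBracket ℝ X Y)
  | congr (X Y : E → E) (hX : IsBracketOn D Ω X) (h : EqOn X Y Ω) : IsBracketOn D Ω Y

theorem IsBracketOn.contDiffOn {D : E → Submodule ℝ E} {Ω : Set E} (hΩ : IsOpen Ω) {Y : E → E}
    (hY : IsBracketOn D Ω Y) : ContDiffOn ℝ ∞ Y Ω := by
  induction hY with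
  | of_section X hX hD => exact hX
  | bracket X Y hX hD hY ih =>
    intro x hx
    exact ((hX.contDiffAt (hΩ.mem_nhds hx)).lieBracket_vectorField
      (ih.contDiffAt (hΩ.mem_nhds hx)) (by simp)).contDiffWithinAt
  | congr X Y hX h ih => exact ih.congr fun x hx => (h hx).symm

/-- A smooth family of injective linear maps between finite-dimensional spaces has, locally, a
smooth family of left inverses. -/
theorem exists_leftInverse_family {Z F : Type*} [NormedAddCommGroup F] [NormedSpace ℝ F]
    [FiniteDimensional ℝ K] [FiniteDimensional ℝ F] [NormedAddCommGroup Z] [NormedSpace ℝ Z]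
    {A : Z → K →L[ℝ] F} {p : Z} (hA : ContDiffAt ℝ ∞ A p)
    (hinj : Function.Injective (A p)) :
    ∃ B : Z → F →L[ℝ] K, ContDiffAt ℝ ∞ B p ∧ ∀ᶠ u in 𝓝 p, ∀ w, B u (A u w) = w := by
  obtain ⟨T₀, hT₀⟩ := LinearMap.exists_leftInverse_of_injective (A p : K →ₗ[ℝ] F)
    (LinearMap.ker_eq_bot.2 hinj)
  set T : F →L[ℝ] K := LinearMap.toContinuousLinearMap T₀ with hT
  have hTid : T.comp (A p) = ContinuousLinearMap.id ℝ K := by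
    ext1 a
    exact LinearMap.congr_fun hT₀ a
  have hTA : ContDiffAt ℝ ∞ (fun u => T.comp (A u)) p := contDiffAt_const.clm_comp hA
  have hinv : ContDiffAt ℝ ∞ ContinuousLinearMap.inverse (T.comp (A p)) := by
    rw [hTid]
    exact contDiffAt_map_inverse (ContinuousLinearEquiv.refl ℝ _)
  -- A left inverse `T` of `A p` makes `T ∘ A u` invertible for `u` near `p`, so `(T ∘ A u)⁻¹ ∘ T`
  -- is a left inverse of `A u`, smooth in `u`.
  refine ⟨fun u => (ContinuousLinearMap.inverse (T.comp (A u))).comp T,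
    (ContDiffAt.comp (f := fun u => T.comp (A u)) p hinv hTA).clm_comp contDiffAt_const, ?_⟩
  have : CompleteSpace K := FiniteDimensional.complete ℝ K
  have hunit : ∀ᶠ u in 𝓝 p, T.comp (A u) ∈
      range ((↑) : (K ≃L[ℝ] K) → K →L[ℝ] K) :=
    hTA.continuousAt.eventually ((ContinuousLinearEquiv.isOpen).mem_nhds
      (by
        change T.comp (A p) ∈ _
        rw [hTid]
        exact ⟨ContinuousLinearEquiv.refl ℝ K, rfl⟩))
  filter_upwards [hunit] with u hu w
  obtain ⟨e, he⟩ := hu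
  rw [ContinuousLinearMap.comp_apply, ← ContinuousLinearMap.comp_apply T, ← he,
    ContinuousLinearMap.inverse_equiv]
  simp

/-- Iterated brackets of vector fields which are tangent to an immersed submanifold are tangent
to it. -/
theorem IsBracketOn.mem_range [FiniteDimensional ℝ E] [FiniteDimensional ℝ K]
    {D : E → Submodule ℝ E} {G : K → E} {p : K} (hG : ContDiffAt ℝ ∞ G p)
    (hinj : Function.Injective (fderiv ℝ G p))
    (hD : ∀ᶠ u in 𝓝 p, D (G u) ≤ LinearMap.range (fderiv ℝ G u).toLinearMap)
    {Ω : Set E} (hΩ : IsOpen Ω) (hp : G p ∈ Ω) {Y : E → E} (hY : IsBracketOn D Ω Y) :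
    Y (G p) ∈ LinearMap.range (fderiv ℝ G p).toLinearMap := by
  obtain ⟨B, hB, hBA⟩ := exists_leftInverse_family (hG.fderiv_right (m := ∞) (by simp)) hinj
  have hev : ∀ᶠ u in 𝓝 p, G u ∈ Ω := hG.continuousAt.eventually (hΩ.mem_nhds hp)
  have section_related : ∀ X : E → E, ContDiffOn ℝ ∞ X Ω → (∀ x ∈ Ω, X x ∈ D x) →
      ∃ η : K → K, ContDiffAt ℝ ∞ η p ∧ ∀ᶠ u in 𝓝 p, fderiv ℝ G u (η u) = X (G u) := by
    intro X hX hXD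
    refine ⟨fun u => B u (X (G u)),
      hB.clm_apply ((hX.contDiffAt (hΩ.mem_nhds hp)).comp p hG), ?_⟩
    filter_upwards [hev, hD, hBA] with u hu hDu hBu
    obtain ⟨w, hw⟩ := hDu (hXD _ hu)
    have hw' : fderiv ℝ G u w = X (G u) := hw
    rw [← hw', hBu]
  have key : ∃ η : K → K, ContDiffAt ℝ ∞ η p ∧ ∀ᶠ u in 𝓝 p, fderiv ℝ G u (η u) = Y (G u) := by
    induction hY with
    | of_section X hX hXD => exact section_related X hX hXD
    | bracket X Y hX hXD hY ih =>
      obtain ⟨η, hη, hηX⟩ := section_related X hX hXD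
      obtain ⟨θ, hθ, hθY⟩ := ih
      refine ⟨VectorField.lieBracket ℝ η θ, hη.lieBracket_vectorField hθ (by simp), ?_⟩
      -- The relation is needed on a neighbourhood of `p`. Smoothness of order `∞` at `p` alone need
      -- not hold at nearby points, as the neighbourhoods may shrink with the order; finite orders
      -- do propagate, and orders two and one suffice.
      have e1 := (hG.of_le (m := 2) (by norm_cast)).eventually (by simp)
      have e2 := (hη.of_le (m := 1) (by norm_cast)).eventually (by simp)
      have e3 := (hθ.of_le (m := 1) (by norm_cast)).eventually (by simp)
      filter_upwards [e1, e2, e3, hev, hηX.eventually_nhds, hθY.eventually_nhds]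
        with u h1 h2 h3 hu h4 h5
      exact fderiv_lieBracket_of_related h1
        ((hX.contDiffAt (hΩ.mem_nhds hu)).differentiableAt (by simp))
        (((hY.contDiffOn hΩ).contDiffAt (hΩ.mem_nhds hu)).differentiableAt (by simp))
        (h2.differentiableAt (by simp)) (h3.differentiableAt (by simp)) h4 h5
    | congr X Y hX h ih =>
      obtain ⟨η, hη, hηX⟩ := ih
      refine ⟨η, hη, ?_⟩
      filter_upwards [hηX, hev] with u hu hu'
      rw [hu, h hu']
  obtain ⟨η, -, hη⟩ := key
  exact ⟨η p, hη.self_of_nhds⟩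

/-- `v` is the initial velocity at `x` of a smooth one-parameter family of local maps which move
points inside their classes for the relation `r`. -/
def IsMoveVector (r : E → E → Prop) (x v : E) : Prop :=
  ∃ F : ℝ × E → E, (∀ᶠ q in 𝓝 ((0 : ℝ), x), ContDiffAt ℝ ∞ F q) ∧
    (∀ᶠ y in 𝓝 x, F (0, y) = y) ∧ fderiv ℝ F (0, x) (1, 0) = v ∧
    ∀ᶠ q in 𝓝 ((0 : ℝ), x), r q.2 (F q)

/-- An immersion at `p` of a `k`-dimensional space in the class of `x₀`. -/
structure IsImmersionInClass (r : E → E → Prop) (O : Set E) (x₀ : E) (G : K → E) (p : K) :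
    Prop where
  contDiffAt : ∀ᶠ u in 𝓝 p, ContDiffAt ℝ ∞ G u
  injective : Function.Injective (fderiv ℝ G p)
  rel : ∀ᶠ u in 𝓝 p, r x₀ (G u)
  mem : G p ∈ O

/-- Injectivity of the differential is an open condition. This lets the maximality argument be
applied at every point of the piece near `p`, as tangency of brackets requires tangency on a
neighbourhood. -/
theorem IsImmersionInClass.eventually [FiniteDimensional ℝ K] {r : E → E → Prop}
    {O : Set E} (hO : IsOpen O) {x₀ : E} {G : K → E} {p : K}
    (h : IsImmersionInClass r O x₀ G p) : ∀ᶠ u in 𝓝 p, IsImmersionInClass r O x₀ G u := by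
  have hG := h.contDiffAt.self_of_nhds
  have h1 : ∀ᶠ u in 𝓝 p, Function.Injective (fderiv ℝ G u) :=
    (hG.fderiv_right (m := ∞) (by simp)).continuousAt.eventually
      (ContinuousLinearMap.isOpen_injective.mem_nhds h.injective)
  filter_upwards [h.contDiffAt.eventually_nhds, h1, h.rel.eventually_nhds,
    hG.continuousAt.eventually (hO.mem_nhds h.mem)] with u h1 h2 h3 h4
  exact ⟨h1, h2, h3, h4⟩

/-- A move which is transversal to an immersion gives an immersion of a space of larger
dimension. -/
theorem IsImmersionInClass.prod {r : E → E → Prop} (hr : Equivalence r)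
    {O : Set E} {x₀ : E} {G : K → E} {p : K} (h : IsImmersionInClass r O x₀ G p) {v : E}
    (hv : IsMoveVector r (G p) v) (hvG : v ∉ LinearMap.range (fderiv ℝ G p).toLinearMap) :
    ∃ G' : K × ℝ → E, IsImmersionInClass r O x₀ G' (p, 0) := by
  obtain ⟨F, hF, hF0, hFv, hFr⟩ := hv
  have hG := h.contDiffAt.self_of_nhds
  have hGd : HasFDerivAt G (fderiv ℝ G p) p := (hG.differentiableAt (by simp)).hasFDerivAt
  have hFd : HasFDerivAt F (fderiv ℝ F (0, G p)) (0, G p) :=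
    (hF.self_of_nhds.differentiableAt (by simp)).hasFDerivAt
  have hmap : HasFDerivAt (fun q : K × ℝ => (q.2, G q.1))
      ((ContinuousLinearMap.snd ℝ K ℝ).prod
        ((fderiv ℝ G p).comp (ContinuousLinearMap.fst ℝ K ℝ))) (p, 0) :=
    hasFDerivAt_snd.prodMk (HasFDerivAt.comp (p, (0 : ℝ)) (g := G) (by exact hGd) hasFDerivAt_fst)
  have hcont : Tendsto (fun q : K × ℝ => (q.2, G q.1)) (𝓝 (p, 0)) (𝓝 ((0 : ℝ), G p)) :=
    hmap.continuousAt
  have hfst : Tendsto (Prod.fst : K × ℝ → K) (𝓝 (p, 0)) (𝓝 p) := continuousAt_fst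
  have hF0' : ∀ y, fderiv ℝ F (0, G p) (0, y) = y := by
    intro y
    have h1 : HasFDerivAt (fun y : E => F (0, y))
        ((fderiv ℝ F (0, G p)).comp (ContinuousLinearMap.inr ℝ ℝ E)) (G p) :=
      HasFDerivAt.comp (G p) (g := F) hFd (hasFDerivAt_prodMk_right _ _)
    have h2 : HasFDerivAt (fun y : E => F (0, y)) (ContinuousLinearMap.id ℝ E) (G p) :=
      (hasFDerivAt_id (G p)).congr_of_eventuallyEq hF0
    simpa using congrArg (fun A : E →L[ℝ] E => A y) (h1.unique h2)
  have hcomp : HasFDerivAt (fun q : K × ℝ => F (q.2, G q.1))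
      ((fderiv ℝ F (0, G p)).comp ((ContinuousLinearMap.snd ℝ K ℝ).prod
        ((fderiv ℝ G p).comp (ContinuousLinearMap.fst ℝ K ℝ)))) (p, 0) :=
    HasFDerivAt.comp (p, (0 : ℝ)) (g := F) (by exact hFd) hmap
  -- The piece is swept along the move. Its differential at `(p, 0)` is `(w, s) ↦ s • v + dG w`,
  -- which is injective because `v` is transversal to the range of `dG`.
  refine ⟨fun q => F (q.2, G q.1), ?_, ?_, ?_, ?_⟩
  · filter_upwards [hcont.eventually hF, hfst.eventually h.contDiffAt] with q h1 h2
    exact ContDiffAt.comp q (g := F) h1 (contDiffAt_snd.prodMk (h2.comp q contDiffAt_fst))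
  · rw [hcomp.fderiv, injective_iff_map_eq_zero]
    rintro ⟨w, s⟩ hws
    have h1 : s • v + fderiv ℝ G p w = 0 := by
      have : ((s, fderiv ℝ G p w) : ℝ × E) = s • (1, 0) + (0, fderiv ℝ G p w) := by simp
      simpa only [ContinuousLinearMap.comp_apply, ContinuousLinearMap.prod_apply,
        ContinuousLinearMap.coe_fst', ContinuousLinearMap.coe_snd', this, map_add, map_smul, hFv,
        hF0'] using hws
    have hs : s = 0 := by
      by_contra hs
      refine hvG ⟨-(s⁻¹ • w), ?_⟩
      have : fderiv ℝ G p w = -(s • v) := (neg_eq_of_add_eq_zero_right h1).symm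
      simp [this, smul_smul, hs]
    subst hs
    have : fderiv ℝ G p w = 0 := by simpa using h1
    rw [h.injective (a₁ := w) (a₂ := 0) (by simpa using this)]
    rfl
  · filter_upwards [hcont.eventually hFr, hfst.eventually h.rel] with q h1 h2
    exact hr.trans h2 h1
  · change F (0, G p) ∈ O
    rw [hF0.self_of_nhds]
    exact h.mem

/-- A local form of the theorem of Chow and Rashevskii: if the moves inside the classes of an
equivalence relation span a bracket generating family of subspaces, then the classes are
neighbourhoods of their points. -/
theorem eventually_rel_of_bracketGenerating [FiniteDimensional ℝ E] {r : E → E → Prop}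
    (hr : Equivalence r) {O : Set E} (hO : IsOpen O) {x₀ : E} (hx₀ : x₀ ∈ O)
    {D : E → Submodule ℝ E}
    (hmove : ∀ x ∈ O, D x ≤ Submodule.span ℝ {v | IsMoveVector r x v})
    (htrans : ∀ x ∈ O, ∀ y ∈ O, r x y → ∀ n ∈ 𝓝 y, ∀ᶠ x' in 𝓝 x, ∃ y' ∈ n, r x' y')
    (hbr : ∀ x ∈ O, Submodule.span ℝ {v | ∃ (Ω : Set E) (Y : E → E), IsOpen Ω ∧ x ∈ Ω ∧
      IsBracketOn D Ω Y ∧ Y x = v} = ⊤) :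
    ∀ᶠ x in 𝓝 x₀, r x₀ x := by
  -- `Q k`: the class of `x₀` contains an immersed piece of dimension `k` meeting `O`. The point
  -- `x₀` gives `Q 0`, and `k` is bounded by the dimension of `E`.
  let Q : ℕ → Prop := fun k => ∃ (K : Type) (_ : NormedAddCommGroup K) (_ : NormedSpace ℝ K)
    (_ : FiniteDimensional ℝ K) (G : K → E) (p : K), Module.finrank ℝ K = k ∧
      IsImmersionInClass r O x₀ G p
  have hQ0 : Q 0 := by
    refine ⟨EuclideanSpace ℝ (Fin 0), inferInstance, inferInstance, inferInstance, fun _ => x₀, 0,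
      by simp, ?_⟩
    exact ⟨Eventually.of_forall fun _ => contDiffAt_const, Function.injective_of_subsingleton _,
      Eventually.of_forall fun _ => hr.refl _, hx₀⟩
  have hQle : ∀ k, Q k → k ≤ Module.finrank ℝ E := by
    rintro k ⟨K, _, _, _, G, p, rfl, h⟩
    exact LinearMap.finrank_le_finrank_of_injective (f := (fderiv ℝ G p).toLinearMap) h.injective
  classical
  set k := Nat.findGreatest Q (Module.finrank ℝ E) with hk
  have hQk : Q k := Nat.findGreatest_spec (Nat.zero_le _) hQ0
  have hmax : ¬ Q (k + 1) := fun h => by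
    have := Nat.le_findGreatest (hQle _ h) h
    omega
  obtain ⟨K, _, _, _, G, p, hfin, h⟩ := hQk
  -- By maximality no move is transversal to the piece at any of its points near `p`.
  have htan : ∀ᶠ u in 𝓝 p, D (G u) ≤ LinearMap.range (fderiv ℝ G u).toLinearMap := by
    filter_upwards [h.eventually hO] with u hu
    refine (hmove _ hu.mem).trans (Submodule.span_le.2 fun v hv => ?_)
    by_contra hvG
    obtain ⟨G', hG'⟩ := hu.prod hr hv hvG
    exact hmax ⟨K × ℝ, inferInstance, inferInstance, inferInstance, G', _,
      by simp [Module.finrank_prod, hfin], hG'⟩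
  have hG := h.contDiffAt.self_of_nhds
  have htop : LinearMap.range (fderiv ℝ G p).toLinearMap = ⊤ := by
    rw [eq_top_iff, ← hbr _ h.mem]
    refine Submodule.span_le.2 ?_
    rintro v ⟨Ω, Y, hΩ, hp, hY, rfl⟩
    exact hY.mem_range hG h.injective htan hΩ hp
  have : CompleteSpace E := FiniteDimensional.complete ℝ E
  have : CompleteSpace K := FiniteDimensional.complete ℝ K
  have hopen : map G (𝓝 p) = 𝓝 (G p) :=
    (hG.hasStrictFDerivAt (by simp)).map_nhds_eq_of_surj htop
  have hn : {y | r x₀ y} ∈ 𝓝 (G p) := by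
    rw [← hopen]
    exact h.rel
  -- The class is now a neighbourhood of `G p`, which may be far from `x₀`. A point `x` near `x₀` is
  -- related to some `y` near `G p`, and such a `y` is already in the class of `x₀`.
  filter_upwards [htrans x₀ hx₀ (G p) h.mem h.rel.self_of_nhds _ hn] with x hx
  obtain ⟨y, hy, hxy⟩ := hx
  exact hr.trans hy (hr.symm hxy)

end LocalChow

/-! ### Straightening submersions; moves and paths in their fibres -/

section Submersion

variable {E F : Type*} [NormedAddCommGroup E] [NormedSpace ℝ E] [FiniteDimensional ℝ E]
  [NormedAddCommGroup F] [NormedSpace ℝ F] [FiniteDimensional ℝ F]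

/-- Inverse function theorem, with the source shrunk to points where the differential is still
invertible, so that the inverse is smooth on the whole target and not only at the image of `x₀`. -/
theorem exists_openPartialHomeomorph_of_contDiffAt {g : E → F} {x₀ : E}
    (hg : ∀ᶠ x in 𝓝 x₀, ContDiffAt ℝ ∞ g x) (e : E ≃L[ℝ] F)
    (he : fderiv ℝ g x₀ = (e : E →L[ℝ] F)) :
    ∃ ψ : OpenPartialHomeomorph E F, x₀ ∈ ψ.source ∧ (∀ x, ψ x = g x) ∧
      (∀ x ∈ ψ.source, ContDiffAt ℝ ∞ ψ x) ∧ ∀ y ∈ ψ.target, ContDiffAt ℝ ∞ ψ.symm y := by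
  have : CompleteSpace E := FiniteDimensional.complete ℝ E
  have hg₀ := hg.self_of_nhds
  have hd : HasFDerivAt g (e : E →L[ℝ] F) x₀ := he ▸ (hg₀.differentiableAt (by simp)).hasFDerivAt
  let Φ := hg₀.toOpenPartialHomeomorph g hd (by simp)
  have hev : ∀ᶠ x in 𝓝 x₀, ContDiffAt ℝ ∞ g x ∧
      fderiv ℝ g x ∈ range ((↑) : (E ≃L[ℝ] F) → E →L[ℝ] F) :=
    hg.and ((hg₀.fderiv_right (m := ∞) (by simp)).continuousAt.eventually
      (ContinuousLinearEquiv.isOpen.mem_nhds ⟨e, he.symm⟩))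
  obtain ⟨O, hOsub, hO, hxO⟩ := eventually_nhds_iff.1 hev
  refine ⟨Φ.restrOpen O hO, ⟨hg₀.mem_toOpenPartialHomeomorph_source hd (by simp), hxO⟩,
    fun x => rfl, ?_, ?_⟩
  · rintro x ⟨-, hx⟩
    exact (hOsub x hx).1
  · intro y hy
    have hx : (Φ.restrOpen O hO).symm y ∈ O := ((Φ.restrOpen O hO).map_target hy).2
    obtain ⟨h1, e', he'⟩ := hOsub _ hx
    refine (Φ.restrOpen O hO).contDiffAt_symm (f₀' := e') hy ?_ h1
    rw [he']
    exact (h1.differentiableAt (by simp)).hasFDerivAt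

/-- A submersion is the first component of a smooth local chart. -/
theorem exists_straightening {f : E → F} {x₀ : E} (hf : ∀ᶠ x in 𝓝 x₀, ContDiffAt ℝ ∞ f x)
    (hsurj : Function.Surjective (fderiv ℝ f x₀)) :
    ∃ ψ : OpenPartialHomeomorph E (F × LinearMap.ker (fderiv ℝ f x₀).toLinearMap),
      x₀ ∈ ψ.source ∧ (∀ x, (ψ x).1 = f x) ∧
      (∀ x ∈ ψ.source, ContDiffAt ℝ ∞ ψ x) ∧ ∀ y ∈ ψ.target, ContDiffAt ℝ ∞ ψ.symm y := by
  have : CompleteSpace E := FiniteDimensional.complete ℝ E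
  have : CompleteSpace F := FiniteDimensional.complete ℝ F
  set A := fderiv ℝ f x₀ with hA
  obtain ⟨P₀, hP₀⟩ := (LinearMap.ker A.toLinearMap).exists_isCompl
  let P : E →L[ℝ] LinearMap.ker A.toLinearMap := LinearMap.toContinuousLinearMap
    ((LinearMap.ker A.toLinearMap).projectionOnto P₀ hP₀)
  have hPr : LinearMap.range P.toLinearMap = ⊤ := Submodule.range_projectionOnto hP₀
  have hPk : LinearMap.ker P.toLinearMap = P₀ := Submodule.ker_projectionOnto hP₀
  have hcompl : IsCompl (LinearMap.ker A.toLinearMap) (LinearMap.ker P.toLinearMap) := by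
    rw [hPk]; exact hP₀
  -- The chart is `x ↦ (f x, P x)`, where `P` projects onto the kernel of the differential at `x₀`.
  let e := A.equivProdOfSurjectiveOfIsCompl P (LinearMap.range_eq_top.2 hsurj) hPr hcompl
  have hder : fderiv ℝ (fun x => (f x, P x)) x₀ = (e : E →L[ℝ] _) := by
    rw [((hf.self_of_nhds.differentiableAt (by simp)).hasFDerivAt.prodMk P.hasFDerivAt).fderiv]
    rfl
  obtain ⟨ψ, h1, h2, h3, h4⟩ := exists_openPartialHomeomorph_of_contDiffAt
    (g := fun x => (f x, P x)) (hf.mono fun x hx => hx.prodMk P.contDiff.contDiffAt) e hder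
  exact ⟨ψ, h1, fun x => by rw [h2], h3, h4⟩

/-- Vectors tangent to the fibres of a submersion are initial velocities of families of maps
preserving the fibres. -/
theorem isMoveVector_of_mem_ker {f : E → F} {x : E} (hf : ∀ᶠ y in 𝓝 x, ContDiffAt ℝ ∞ f y)
    (hsurj : Function.Surjective (fderiv ℝ f x)) {v : E} (hv : fderiv ℝ f x v = 0)
    {r : E → E → Prop} (hr : ∀ᶠ q in 𝓝 (x, x), f q.1 = f q.2 → r q.1 q.2) :
    IsMoveVector r x v := by
  obtain ⟨ψ, hx, hψf, hψ, hψs⟩ := exists_straightening hf hsurj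
  set w := fderiv ℝ ψ x v with hw
  have hψd : HasFDerivAt ψ (fderiv ℝ ψ x) x := ((hψ x hx).differentiableAt (by simp)).hasFDerivAt
  have hw1 : w.1 = 0 := by
    have h1 : HasFDerivAt (fun y => (ψ y).1)
        ((ContinuousLinearMap.fst ℝ _ _).comp (fderiv ℝ ψ x)) x := hψd.fst
    rw [show (fun y => (ψ y).1) = f from funext hψf] at h1
    rw [h1.fderiv] at hv
    exact hv
  have hin : Continuous fun q : ℝ × F × LinearMap.ker (fderiv ℝ f x).toLinearMap =>
    q.2 + q.1 • w := by fun_prop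
  have hψc : ContinuousAt ψ x := hψd.continuousAt
  have harg : ContinuousAt (fun q : ℝ × E => ψ q.2 + q.1 • w) (0, x) := by
    refine ContinuousAt.add ?_ (by fun_prop)
    exact ContinuousAt.comp (g := ψ) (f := Prod.snd) (by exact hψc) continuousAt_snd
  have htgt : ∀ᶠ q in 𝓝 ((0 : ℝ), x), ψ q.2 + q.1 • w ∈ ψ.target :=
    harg.eventually (ψ.open_target.mem_nhds (by simpa using ψ.map_source hx))
  have hsrc : ∀ᶠ q in 𝓝 ((0 : ℝ), x), q.2 ∈ ψ.source :=
    continuousAt_snd.eventually (ψ.open_source.mem_nhds hx)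
  have hsmooth : ∀ᶠ q in 𝓝 ((0 : ℝ), x),
      ContDiffAt ℝ ∞ (fun q : ℝ × E => ψ.symm (ψ q.2 + q.1 • w)) q := by
    filter_upwards [htgt, hsrc] with q h1 h2
    refine ContDiffAt.comp q (hψs _ h1) ?_
    exact ((hψ _ h2).comp q contDiffAt_snd).add (contDiffAt_fst.smul contDiffAt_const)
  -- Translation in the straightened coordinates in the direction `w = dψ v`. Since `df v = 0`, the
  -- first component of `w` vanishes and `f` is preserved.
  refine ⟨fun q => ψ.symm (ψ q.2 + q.1 • w), hsmooth, ?_, ?_, ?_⟩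
  · filter_upwards [ψ.open_source.mem_nhds hx] with y hy
    simp [ψ.left_inv hy]
  · have hsd : HasFDerivAt ψ.symm (fderiv ℝ ψ.symm (ψ x)) (ψ x) :=
      ((hψs _ (ψ.map_source hx)).differentiableAt (by simp)).hasFDerivAt
    have hid : fderiv ℝ ψ.symm (ψ x) w = v := by
      have h1 : HasFDerivAt (ψ.symm ∘ ψ) ((fderiv ℝ ψ.symm (ψ x)).comp (fderiv ℝ ψ x)) x :=
        hsd.comp x hψd
      have h2 : HasFDerivAt (ψ.symm ∘ ψ) (ContinuousLinearMap.id ℝ E) x :=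
        (hasFDerivAt_id x).congr_of_eventuallyEq (by
          filter_upwards [ψ.open_source.mem_nhds hx] with y hy
          simp [ψ.left_inv hy])
      simpa using congrArg (fun A : E →L[ℝ] E => A v) (h1.unique h2)
    have h3 : HasFDerivAt (fun s : ℝ => ψ x + s • w)
        ((1 : ℝ →L[ℝ] ℝ).smulRight w) 0 :=
      ((ContinuousLinearMap.smulRight (1 : ℝ →L[ℝ] ℝ) w).hasFDerivAt).const_add (ψ x)
    have h4 : HasFDerivAt (fun s : ℝ => ψ.symm (ψ x + s • w))
        ((fderiv ℝ ψ.symm (ψ x)).comp ((1 : ℝ →L[ℝ] ℝ).smulRight w)) 0 :=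
      HasFDerivAt.comp (0 : ℝ) (g := ψ.symm) (by simpa using hsd) h3
    have h5 : HasFDerivAt (fun s : ℝ => ψ.symm (ψ x + s • w))
        ((fderiv ℝ (fun q : ℝ × E => ψ.symm (ψ q.2 + q.1 • w)) (0, x)).comp
          (ContinuousLinearMap.inl ℝ ℝ E)) 0 :=
      HasFDerivAt.comp (0 : ℝ) (g := fun q : ℝ × E => ψ.symm (ψ q.2 + q.1 • w))
        (f := fun s : ℝ => (s, x)) (hsmooth.self_of_nhds.differentiableAt (by simp)).hasFDerivAt
        (hasFDerivAt_prodMk_left (𝕜 := ℝ) (0 : ℝ) x)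
    have := congrArg (fun A : ℝ →L[ℝ] E => A 1) (h5.unique h4)
    simpa [hid] using this
  · have hcont : ContinuousAt (fun q : ℝ × E => (q.2, ψ.symm (ψ q.2 + q.1 • w))) (0, x) :=
      continuousAt_snd.prodMk hsmooth.self_of_nhds.continuousAt
    have hlim : Tendsto (fun q : ℝ × E => (q.2, ψ.symm (ψ q.2 + q.1 • w))) (𝓝 (0, x))
        (𝓝 (x, x)) := by
      simpa [ContinuousAt, ψ.left_inv hx] using hcont
    filter_upwards [hlim.eventually hr, htgt] with q h1 h2
    refine h1 ?_
    rw [← hψf (ψ.symm _), ψ.right_inv h2, ← hψf]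
    simp [hw1]

/-- Points on a common fibre of a submersion which are close to `x₀` are joined by a smooth curve
in the fibre. -/
theorem exists_fibre_paths {f : E → F} {x₀ : E} (hf : ∀ᶠ x in 𝓝 x₀, ContDiffAt ℝ ∞ f x)
    (hsurj : Function.Surjective (fderiv ℝ f x₀)) {U : Set E} (hU : U ∈ 𝓝 x₀) :
    ∀ᶠ q in 𝓝 (x₀, x₀), f q.1 = f q.2 → ∃ γ : ℝ → E, ContDiff ℝ ∞ γ ∧
      (∀ t ≤ 0, γ t = q.1) ∧ (∀ t, 1 ≤ t → γ t = q.2) ∧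
      (∀ t, γ t ∈ U) ∧ ∀ t, f (γ t) = f q.1 := by
  obtain ⟨ψ, hx, hψf, hψ, hψs⟩ := exists_straightening hf hsurj
  have hN : ψ.target ∩ ψ.symm ⁻¹' U ∈ 𝓝 (ψ x₀) := by
    refine inter_mem (ψ.open_target.mem_nhds (ψ.map_source hx)) ?_
    refine (hψs _ (ψ.map_source hx)).continuousAt.preimage_mem_nhds ?_
    rwa [ψ.left_inv hx]
  obtain ⟨ε, hε, hball⟩ := Metric.mem_nhds_iff.1 hN
  have hev : ∀ᶠ x in 𝓝 x₀, x ∈ ψ.source ∧ ψ x ∈ Metric.ball (ψ x₀) ε :=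
    (eventually_mem_set.2 (ψ.open_source.mem_nhds hx)).and
      ((hψ _ hx).continuousAt.eventually (Metric.ball_mem_nhds _ hε))
  rw [nhds_prod_eq]
  filter_upwards [hev.prod_mk hev] with q hq hfq
  obtain ⟨⟨hxs, hxb⟩, hys, hyb⟩ := hq
  have hseg : ∀ t, ψ q.1 + Real.smoothTransition t • (ψ q.2 - ψ q.1) ∈ Metric.ball (ψ x₀) ε :=
    fun t => (convex_ball _ _).add_smul_sub_mem hxb hyb
      ⟨Real.smoothTransition.nonneg t, Real.smoothTransition.le_one t⟩
  -- A segment in the straightened chart, kept in the target by convexity of the ball.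
  -- `Real.smoothTransition` makes the curve rest outside `[0, 1]`, so that curves can later be
  -- concatenated smoothly.
  refine ⟨fun t => ψ.symm (ψ q.1 + Real.smoothTransition t • (ψ q.2 - ψ q.1)), ?_, ?_, ?_,
    fun t => (hball (hseg t)).2, ?_⟩
  · rw [contDiff_iff_contDiffAt]
    intro t
    refine ContDiffAt.comp t (hψs _ (hball (hseg t)).1) ?_
    exact contDiffAt_const.add
      (Real.smoothTransition.contDiff.contDiffAt.smul contDiffAt_const)
  · intro t ht
    simp [Real.smoothTransition.zero_of_nonpos ht, ψ.left_inv hxs]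
  · intro t ht
    simp [Real.smoothTransition.one_of_one_le ht, ψ.left_inv hys]
  · intro t
    rw [← hψf (ψ.symm _), ψ.right_inv (hball (hseg t)).1, ← hψf q.1]
    simp [hψf, hfq]

end Submersion

/-! ### Distributions, brackets and integrability in a chart -/

section Coordinates

variable {m : ℕ} {M : Type*} [TopologicalSpace M]
  [ChartedSpace (EuclideanSpace ℝ (Fin m)) M] [IsManifold (𝓡 m) ∞ M]

/-- The inverse of the preferred chart at `z₀`. -/
abbrev chartInv (z₀ : M) : EuclideanSpace ℝ (Fin m) → M := (extChartAt (𝓡 m) z₀).symm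

/-- The differential of the inverse of the preferred chart at `z₀`. -/
abbrev chartInvDeriv (z₀ : M) (ξ : EuclideanSpace ℝ (Fin m)) :
    EuclideanSpace ℝ (Fin m) →L[ℝ] TangentSpace (𝓡 m) (chartInv z₀ ξ) :=
  mfderiv (𝓡 m) (𝓡 m) (chartInv z₀) ξ

theorem isManifold_minSmoothness_two : IsManifold (𝓡 m) (minSmoothness ℝ 2) M := by
  rw [minSmoothness_of_isRCLikeNormedField]
  infer_instance

theorem contMDiffAt_chartInv {z₀ : M} {ξ : EuclideanSpace ℝ (Fin m)}
    (hξ : ξ ∈ (extChartAt (𝓡 m) z₀).target) :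
    ContMDiffAt (𝓡 m) (𝓡 m) ∞ (chartInv z₀) ξ :=
  (contMDiffOn_extChartAt_symm z₀).contMDiffAt ((isOpen_extChartAt_target z₀).mem_nhds hξ)

theorem isInvertible_chartInvDeriv {z₀ : M} {ξ : EuclideanSpace ℝ (Fin m)}
    (hξ : ξ ∈ (extChartAt (𝓡 m) z₀).target) : (chartInvDeriv z₀ ξ).IsInvertible := by
  have := isInvertible_mfderivWithin_extChartAt_symm (I := 𝓡 m) hξ
  rwa [ModelWithCorners.range_eq_univ, mfderivWithin_univ] at this

namespace TangentDistribution

/-- A distribution read in the preferred chart at `z₀`. -/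
def coord (D : TangentDistribution m M) (z₀ : M) (ξ : EuclideanSpace ℝ (Fin m)) :
    Submodule ℝ (EuclideanSpace ℝ (Fin m)) :=
  (D.fiber (chartInv z₀ ξ)).comap (chartInvDeriv z₀ ξ).toLinearMap

theorem mem_coord (D : TangentDistribution m M) {z₀ : M} {ξ v : EuclideanSpace ℝ (Fin m)} :
    v ∈ D.coord z₀ ξ ↔ chartInvDeriv z₀ ξ v ∈ D.fiber (chartInv z₀ ξ) := Iff.rfl

theorem IsIteratedBracketOn.contMDiffOn {D : TangentDistribution m M} {O : Set M} (hO : IsOpen O)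
    {Y : ∀ z : M, TangentSpace (𝓡 m) z} (hY : D.IsIteratedBracketOn O Y) :
    ContMDiffOn (𝓡 m) (𝓡 m).tangent ∞ (fun z => (⟨z, Y z⟩ : TangentBundle (𝓡 m) M)) O := by
  induction hY with
  | of_section X hX => exact hX.smooth
  | bracket X Y hX hY ih =>
    have := isManifold_minSmoothness_two (m := m) (M := M)
    have : IsManifold (𝓡 m) (((⊤ : ℕ∞) : WithTop ℕ∞) + 1) M := by
      rw [show ((⊤ : ℕ∞) : WithTop ℕ∞) + 1 = ∞ from rfl]
      infer_instance
    intro z hz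
    exact (ContMDiffAt.mlieBracket_vectorField (n := ⊤) (m := ⊤)
      (hX.smooth.contMDiffAt (hO.mem_nhds hz))
      (ih.contMDiffAt (hO.mem_nhds hz)) (by simp)).contMDiffWithinAt

/-- A vector field read in the preferred chart at `z₀`. -/
def coordField (z₀ : M) (X : ∀ z : M, TangentSpace (𝓡 m) z) :
    EuclideanSpace ℝ (Fin m) → EuclideanSpace ℝ (Fin m) :=
  VectorField.mpullback (𝓡 m) (𝓡 m) (chartInv z₀) X

theorem chartInvDeriv_coordField {z₀ : M} (X : ∀ z : M, TangentSpace (𝓡 m) z)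
    {ξ : EuclideanSpace ℝ (Fin m)} (hξ : ξ ∈ (extChartAt (𝓡 m) z₀).target) :
    chartInvDeriv z₀ ξ (coordField z₀ X ξ) = X (chartInv z₀ ξ) := by
  obtain ⟨e, he⟩ := isInvertible_chartInvDeriv hξ
  rw [coordField, VectorField.mpullback_apply]
  change chartInvDeriv z₀ ξ ((chartInvDeriv z₀ ξ).inverse _) = _
  rw [← he, ContinuousLinearMap.inverse_equiv]
  simp

theorem contDiffOn_coordField {z₀ : M} {O : Set M} (hO : IsOpen O)
    {X : ∀ z : M, TangentSpace (𝓡 m) z}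
    (hX : ContMDiffOn (𝓡 m) (𝓡 m).tangent ∞ (fun z => (⟨z, X z⟩ : TangentBundle (𝓡 m) M)) O) :
    ContDiffOn ℝ ∞ (coordField z₀ X) ((extChartAt (𝓡 m) z₀).target ∩ chartInv z₀ ⁻¹' O) := by
  rintro ξ ⟨hξ, hξO⟩
  have h := ContMDiffAt.mpullback_vectorField_preimage (m := ∞) (n := ∞)
    (hX.contMDiffAt (hO.mem_nhds hξO)) (contMDiffAt_chartInv hξ) (isInvertible_chartInvDeriv hξ)
    (by simp)
  have h2 := (contMDiff_snd_tangentBundle_modelSpace (n := ∞)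
    (EuclideanSpace ℝ (Fin m)) (𝓡 m)).contMDiffAt.comp ξ h
  exact (contMDiffAt_iff_contDiffAt.1 h2).contDiffWithinAt

/-- Pullback by a local diffeomorphism commutes with Lie brackets. The identity is available only on
the chart domain over `O`, which is what the `congr` constructor of `IsBracketOn` absorbs. -/
theorem IsIteratedBracketOn.coord {D : TangentDistribution m M} {O : Set M} (hO : IsOpen O)
    (z₀ : M) {Y : ∀ z : M, TangentSpace (𝓡 m) z} (hY : D.IsIteratedBracketOn O Y) :
    IsBracketOn (D.coord z₀) ((extChartAt (𝓡 m) z₀).target ∩ chartInv z₀ ⁻¹' O)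
      (coordField z₀ Y) := by
  have hsec : ∀ X : ∀ z : M, TangentSpace (𝓡 m) z, D.IsSectionOn X O →
      ∀ ξ ∈ (extChartAt (𝓡 m) z₀).target ∩ chartInv z₀ ⁻¹' O,
        coordField z₀ X ξ ∈ D.coord z₀ ξ := by
    intro X hX ξ hξ
    rw [mem_coord, chartInvDeriv_coordField X hξ.1]
    exact hX.mem _ hξ.2
  induction hY with
  | of_section X hX => exact .of_section _ (contDiffOn_coordField hO hX.smooth) (hsec X hX)
  | bracket X Y hX hY ih =>
    have := isManifold_minSmoothness_two (m := m) (M := M)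
    refine .congr _ _ (.bracket _ _ (contDiffOn_coordField hO hX.smooth) (hsec X hX) ih) ?_
    rintro ξ ⟨hξ, hξO⟩
    have h := VectorField.mpullback_mlieBracket (n := ∞)
      ((hX.smooth.contMDiffAt (hO.mem_nhds hξO)).mdifferentiableAt (by simp))
      (((hY.contMDiffOn hO).contMDiffAt (hO.mem_nhds hξO)).mdifferentiableAt (by simp))
      (contMDiffAt_chartInv hξ)
      (by rw [minSmoothness_of_isRCLikeNormedField]; norm_cast)
    have h' : VectorField.mlieBracket (𝓡 m)
        (VectorField.mpullback (𝓡 m) (𝓡 m) (chartInv z₀) X)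
        (VectorField.mpullback (𝓡 m) (𝓡 m) (chartInv z₀) Y) ξ =
        VectorField.lieBracket ℝ (coordField z₀ X) (coordField z₀ Y) ξ := by
      rw [← VectorField.mlieBracketWithin_univ,
        VectorField.mlieBracketWithin_eq_lieBracketWithin]
      exact congrFun (VectorField.lieBracketWithin_univ (V := coordField z₀ X)
        (W := coordField z₀ Y)) ξ
    exact (h.trans h').symm

/-- Bracket generation, read in a chart. -/
theorem IsBracketGeneratingAt.coord {D : TangentDistribution m M} {z₀ : M}
    {ξ : EuclideanSpace ℝ (Fin m)} (hξ : ξ ∈ (extChartAt (𝓡 m) z₀).target)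
    (h : D.IsBracketGeneratingAt (chartInv z₀ ξ)) :
    Submodule.span ℝ {v | ∃ (Ω : Set (EuclideanSpace ℝ (Fin m)))
      (Y : EuclideanSpace ℝ (Fin m) → EuclideanSpace ℝ (Fin m)), IsOpen Ω ∧ ξ ∈ Ω ∧
      IsBracketOn (D.coord z₀) Ω Y ∧ Y ξ = v} = ⊤ := by
  obtain ⟨e, he⟩ := isInvertible_chartInvDeriv hξ
  rw [eq_top_iff]
  intro v _
  have hle : (⊤ : Submodule ℝ (TangentSpace (𝓡 m) (chartInv z₀ ξ))) ≤
      (Submodule.span ℝ {v | ∃ (Ω : Set (EuclideanSpace ℝ (Fin m)))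
      (Y : EuclideanSpace ℝ (Fin m) → EuclideanSpace ℝ (Fin m)), IsOpen Ω ∧ ξ ∈ Ω ∧
      IsBracketOn (D.coord z₀) Ω Y ∧ Y ξ = v}).map (chartInvDeriv z₀ ξ).toLinearMap := by
    rw [← h]
    refine Submodule.span_le.2 ?_
    rintro w ⟨O, X, hO, hz, hX, rfl⟩
    exact ⟨coordField z₀ X ξ, Submodule.subset_span ⟨_, _,
      (continuousOn_extChartAt_symm z₀).isOpen_inter_preimage (isOpen_extChartAt_target z₀) hO,
      ⟨hξ, hz⟩, hX.coord hO z₀, rfl⟩, chartInvDeriv_coordField X hξ⟩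
  obtain ⟨w, hw, hwv⟩ := hle (Submodule.mem_top (x := chartInvDeriv z₀ ξ v))
  have : w = v := by
    refine e.injective ?_
    have hwv' : chartInvDeriv z₀ ξ w = chartInvDeriv z₀ ξ v := hwv
    rw [← he] at hwv'
    exact hwv'
  rwa [← this]

/-- Integrability, read in a chart. -/
theorem IsIntegrable.coord {D : TangentDistribution m M} (hD : D.IsIntegrable) (z₀ : M) :
    ∃ (O : Set (EuclideanSpace ℝ (Fin m))) (q : ℕ)
      (f : EuclideanSpace ℝ (Fin m) → EuclideanSpace ℝ (Fin q)), IsOpen O ∧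
      extChartAt (𝓡 m) z₀ z₀ ∈ O ∧ O ⊆ (extChartAt (𝓡 m) z₀).target ∧
      (∀ ξ ∈ O, ContDiffAt ℝ ∞ f ξ ∧ Function.Surjective (fderiv ℝ f ξ) ∧
        ∀ v, fderiv ℝ f ξ v = 0 ↔ v ∈ D.coord z₀ ξ) := by
  obtain ⟨O, q, f, hO, hz, hf, hd⟩ := hD z₀
  refine ⟨(extChartAt (𝓡 m) z₀).target ∩ chartInv z₀ ⁻¹' O, q, f ∘ chartInv z₀,
    (continuousOn_extChartAt_symm z₀).isOpen_inter_preimage (isOpen_extChartAt_target z₀) hO,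
    ⟨mem_extChartAt_target z₀, by rwa [mem_preimage, chartInv, extChartAt_to_inv]⟩,
    inter_subset_left, ?_⟩
  rintro ξ ⟨hξ, hξO⟩
  have hfξ : ContMDiffAt (𝓡 m) (𝓡 q) ∞ f (chartInv z₀ ξ) := hf.contMDiffAt (hO.mem_nhds hξO)
  have hder : fderiv ℝ (f ∘ chartInv z₀) ξ =
      (mfderiv (𝓡 m) (𝓡 q) f (chartInv z₀ ξ)).comp (chartInvDeriv z₀ ξ) := by
    rw [← mfderiv_eq_fderiv]
    exact mfderiv_comp ξ (hfξ.mdifferentiableAt (by simp))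
      ((contMDiffAt_chartInv hξ).mdifferentiableAt (by simp))
  obtain ⟨hs, hk⟩ := hd _ hξO
  refine ⟨contMDiffAt_iff_contDiffAt.1 (hfξ.comp ξ (contMDiffAt_chartInv hξ)), ?_, fun v => ?_⟩
  · rw [hder]
    obtain ⟨e, he⟩ := isInvertible_chartInvDeriv hξ
    rw [← he]
    exact hs.comp e.surjective
  · rw [mem_coord, hder, ← hk]
    rfl

end TangentDistribution

theorem PseudoProductStructure.coord_E_le (S : PseudoProductStructure m M) {z₀ : M}
    {ξ : EuclideanSpace ℝ (Fin m)} (hξ : ξ ∈ (extChartAt (𝓡 m) z₀).target) :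
    S.E.coord z₀ ξ ≤ S.L.coord z₀ ξ ⊔ S.K.coord z₀ ξ := by
  intro v hv
  rw [TangentDistribution.mem_coord, ← S.sup_eq] at hv
  obtain ⟨l, hl, k, hk, hlk⟩ := Submodule.mem_sup.1 hv
  obtain ⟨e, he⟩ := isInvertible_chartInvDeriv hξ
  refine Submodule.mem_sup.2 ⟨e.symm l, ?_, e.symm k, ?_, ?_⟩
  · rw [TangentDistribution.mem_coord, ← he]
    simpa using hl
  · rw [TangentDistribution.mem_coord, ← he]
    simpa using hk
  · rw [← map_add, hlk, ← he]
    simp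

end Coordinates

/-! ### From smooth curves tangent to `E` to trajectories -/

section Trajectories

variable {m : ℕ} {M : Type*} [TopologicalSpace M]
  [ChartedSpace (EuclideanSpace ℝ (Fin m)) M] [IsManifold (𝓡 m) ∞ M]

/-- The total space of a distribution carries the topology induced from the tangent bundle. -/
theorem TangentDistribution.continuous_of_continuous_incl (D : TangentDistribution m M)
    {T : Type*} [TopologicalSpace T] {c : T → D.Total} (h : Continuous fun t => D.incl (c t)) :
    Continuous c := by
  rw [continuous_iff_continuousAt]
  intro t
  obtain ⟨hproj, hvel⟩ := (FiberBundle.continuousAt_totalSpace (EuclideanSpace ℝ (Fin m))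
    (fun t => D.incl (c t))).1 h.continuousAt
  have hproj' : ContinuousAt (fun s => (c s).proj) t := hproj
  refine (FiberBundle.continuousAt_totalSpace (EuclideanSpace ℝ (Fin D.rank)) c).2 ⟨hproj', ?_⟩
  set z₀ := (c t).proj with hz₀
  set s := (D.exists_frame z₀).choose_spec.2.2.choose
  set O := (D.exists_frame z₀).choose
  have hO : IsOpen O := (D.exists_frame z₀).choose_spec.1
  have hzO : z₀ ∈ O := (D.exists_frame z₀).choose_spec.2.1
  have hs : IsFrameOn D.fiber s O := (D.exists_frame z₀).choose_spec.2.2.choose_spec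
  let e := trivializationAt (EuclideanSpace ℝ (Fin m)) (TangentSpace (𝓡 m) : M → Type _) z₀
  have hzB : z₀ ∈ e.baseSet := FiberBundle.mem_baseSet_trivializationAt' z₀
  have hinj : Function.Injective (frameMatrix s z₀ z₀) := by
    intro a b hab
    rw [frameMatrix_apply s hzB, frameMatrix_apply s hzB] at hab
    refine hs.injective hzO ?_
    have := congrArg (e.symmₗ ℝ z₀) hab
    rwa [Trivialization.symmₗ_linearMapAt _ hzB, Trivialization.symmₗ_linearMapAt _ hzB] at this
  -- The frame coordinates of `c u` are recovered from its image in the tangent bundle by a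
  -- continuous left inverse of the frame matrix.
  obtain ⟨B, hB, hBA⟩ := exists_leftInverse_family (A := id) (p := frameMatrix s z₀ z₀)
    contDiffAt_id hinj
  have hA : ContinuousAt (fun u => frameMatrix s z₀ (c u).proj) t :=
    ContinuousAt.comp (f := fun u => (c u).proj) (g := frameMatrix s z₀)
      (((contMDiffOn_frameMatrix hO hs z₀).contMDiffAt
        ((hO.inter e.open_baseSet).mem_nhds ⟨hzO, hzB⟩)).continuousAt) hproj'
  have hlim : ContinuousAt (fun u => B (frameMatrix s z₀ (c u).proj) (e (D.incl (c u))).2) t :=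
    (ContinuousAt.comp (f := fun u => frameMatrix s z₀ (c u).proj) (g := B)
      hB.continuousAt hA).clm_apply hvel
  refine hlim.congr ?_
  filter_upwards [hA.eventually hBA, hproj'.eventually
    ((hO.inter e.open_baseSet).mem_nhds ⟨hzO, hzB⟩)] with u hu huO
  have h1 : (trivializationAt (EuclideanSpace ℝ (Fin D.rank)) D.Fib z₀ (c u)).2 =
      (hs.equiv huO.1).symm (c u).snd :=
    congrArg Prod.snd (D.framePretrivialization_apply hO hs huO.1 (c u).snd)
  rw [h1]
  have h2 : (e (D.incl (c u))).2 =
      frameMatrix s z₀ (c u).proj ((hs.equiv huO.1).symm (c u).snd) := by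
    rw [frameMatrix_apply s huO.2, ← hs.coe_equiv huO.1, LinearEquiv.apply_symm_apply,
      Trivialization.coe_linearMapAt_of_mem _ huO.2]
    rfl
  rw [h2]
  exact hu _

/-- In a chart the curve is `C¹` on a compact interval, hence Lipschitz there, hence absolutely
continuous. -/
theorem isAbsolutelyContinuousCurve_of_contMDiff {γ : ℝ → M}
    (hγ : ContMDiff 𝓘(ℝ, ℝ) (𝓡 m) ∞ γ) (a b : ℝ) :
    IsAbsolutelyContinuousCurve (𝓡 m) γ a b where
  continuousOn := hγ.continuous.continuousOn
  absolutelyContinuous q c d _ hcd _ hmaps := by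
    have hsmooth : ContDiffOn ℝ 1 (fun t => extChartAt (𝓡 m) q (γ t)) (Icc c d) := by
      intro t ht
      have h1 : ContMDiffAt 𝓘(ℝ, ℝ) (𝓡 m) ∞ (fun t => extChartAt (𝓡 m) q (γ t)) t :=
        ContMDiffAt.comp t (contMDiffAt_extChartAt' (hmaps ht)) hγ.contMDiffAt
      exact ((contMDiffAt_iff_contDiffAt.1 h1).of_le (by norm_cast)).contDiffWithinAt
    obtain ⟨k, hk⟩ := (hsmooth.locallyLipschitzOn (convex_Icc c d)).exists_lipschitzOnWith_of_compact
      isCompact_Icc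
    exact LipschitzOnWith.absolutelyContinuousOnInterval (K := k) (by rwa [uIcc_of_le hcd])

/-- A continuous control with smooth projection is admissible as soon as it satisfies the
differential equation. -/
theorem ControlSystem.isAdmissible_of_continuous {EU HU U : Type*}
    [NormedAddCommGroup EU] [NormedSpace ℝ EU] [TopologicalSpace HU] [TopologicalSpace U]
    [ChartedSpace HU U] {IU : ModelWithCorners ℝ EU HU} (C : ControlSystem IU U (𝓡 m) M)
    {c : ℝ → U} (hc : Continuous c)
    (hγ : ContMDiff 𝓘(ℝ, ℝ) (𝓡 m) ∞ fun t => C.proj (c t))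
    (hd : ∀ t, mfderiv 𝓘(ℝ, ℝ) (𝓡 m) (fun t => C.proj (c t)) t (1 : ℝ) = C.vel (c t))
    (a b : ℝ) : C.IsAdmissible c a b where
  aemeasurable := by
    let _ : MeasurableSpace U := borel U
    have : BorelSpace U := ⟨rfl⟩
    exact hc.aemeasurable
  essentiallyBounded := by
    refine ⟨c '' Icc a b, isCompact_Icc.image hc, ?_⟩
    filter_upwards [ae_restrict_mem measurableSet_Icc] with t ht
    exact mem_image_of_mem c ht
  absolutelyContinuous := isAbsolutelyContinuousCurve_of_contMDiff hγ a b
  hasMFDerivAt := by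
    refine Eventually.of_forall fun t => ?_
    have h := ((hγ t).mdifferentiableAt (by simp)).hasMFDerivAt
    have key : ((1 : ℝ →L[ℝ] ℝ).smulRight (C.vel (c t) : EuclideanSpace ℝ (Fin m))) =
        (mfderiv 𝓘(ℝ, ℝ) (𝓡 m) (fun t => C.proj (c t)) t : ℝ →L[ℝ] EuclideanSpace ℝ (Fin m)) := by
      refine ContinuousLinearMap.ext_ring ?_
      change (1 : ℝ) • (C.vel (c t) : EuclideanSpace ℝ (Fin m)) = _
      rw [one_smul]
      exact (hd t).symm
    exact key ▸ h

/-- The velocity of a curve, as a curve in the tangent bundle. -/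
def velocityCurve (γ : ℝ → M) (t : ℝ) : TangentBundle (𝓡 m) M :=
  ⟨γ t, mfderiv 𝓘(ℝ, ℝ) (𝓡 m) γ t (1 : ℝ)⟩

theorem continuous_velocityCurve {γ : ℝ → M} (hγ : ContMDiff 𝓘(ℝ, ℝ) (𝓡 m) ∞ γ) :
    Continuous (velocityCurve (m := m) γ) := by
  have h1 : Continuous (tangentMap 𝓘(ℝ, ℝ) (𝓡 m) γ) := hγ.continuous_tangentMap (by simp)
  have h2 : Continuous fun t : ℝ => (⟨t, (1 : ℝ)⟩ : TangentBundle 𝓘(ℝ, ℝ) ℝ) :=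
    (tangentBundleModelSpaceHomeomorph 𝓘(ℝ, ℝ)).symm.continuous.comp
      (continuous_id.prodMk continuous_const : Continuous fun t : ℝ => (t, (1 : ℝ)))
  exact h1.comp h2

namespace PseudoProductStructure

variable (S : PseudoProductStructure m M)

/-- The curve `lam` in the tangent bundle is near `t` the `L`-component of the velocity of its
projection, a smooth curve in `V` tangent to `E = L ⊕ K`. -/
structure IsLiftAt (V : Set M) (lam : ℝ → TangentBundle (𝓡 m) M) (t : ℝ) : Prop where
  continuousAt : ContinuousAt lam t
  contMDiffAt : ContMDiffAt 𝓘(ℝ, ℝ) (𝓡 m) ∞ (fun s => (lam s).proj) t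
  mem : (lam t).proj ∈ V
  mem_L : (lam t).snd ∈ S.L.fiber (lam t).proj
  sub_mem_K : mfderiv 𝓘(ℝ, ℝ) (𝓡 m) (fun s => (lam s).proj) t (1 : ℝ) - (lam t).snd ∈
    S.K.fiber (lam t).proj

variable {S}

theorem IsLiftAt.congr {V : Set M} {lam lam' : ℝ → TangentBundle (𝓡 m) M} {t : ℝ}
    (h : S.IsLiftAt V lam t) (heq : lam' =ᶠ[𝓝 t] lam) : S.IsLiftAt V lam' t := by
  have hpt : lam' t = lam t := heq.self_of_nhds
  have hproj : (fun s => (lam' s).proj) =ᶠ[𝓝 t] fun s => (lam s).proj :=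
    heq.mono fun s hs => congrArg TotalSpace.proj hs
  have hd : (mfderiv 𝓘(ℝ, ℝ) (𝓡 m) (fun s => (lam' s).proj) t : ℝ →L[ℝ] EuclideanSpace ℝ (Fin m)) =
      mfderiv 𝓘(ℝ, ℝ) (𝓡 m) (fun s => (lam s).proj) t := hproj.mfderiv_eq
  -- The two conditions live over base points that are only propositionally equal; the velocity is
  -- kept in the model space while the point varies.
  have aux : ∀ (w : EuclideanSpace ℝ (Fin m)) (p q : TangentBundle (𝓡 m) M), p = q →
      (show TangentSpace (𝓡 m) q.proj from w) - q.snd ∈ S.K.fiber q.proj →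
      (show TangentSpace (𝓡 m) p.proj from w) - p.snd ∈ S.K.fiber p.proj := by
    rintro w p q rfl h
    exact h
  refine ⟨h.continuousAt.congr heq.symm, h.contMDiffAt.congr_of_eventuallyEq hproj, ?_, ?_, ?_⟩
  · rw [hpt]; exact h.mem
  · rw [hpt]; exact h.mem_L
  · refine aux _ _ _ hpt ?_
    have := congrArg (fun A : ℝ →L[ℝ] EuclideanSpace ℝ (Fin m) => A 1) hd
    erw [this]
    exact h.sub_mem_K

theorem IsLiftAt.comp_add {V : Set M} {lam : ℝ → TangentBundle (𝓡 m) M} {t c : ℝ}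
    (h : S.IsLiftAt V lam (t + c)) : S.IsLiftAt V (fun s => lam (s + c)) t := by
  have hadd : ContMDiffAt 𝓘(ℝ, ℝ) 𝓘(ℝ, ℝ) ∞ (fun s : ℝ => s + c) t :=
    (contDiffAt_id.add contDiffAt_const).contMDiffAt
  refine ⟨ContinuousAt.comp (f := fun s : ℝ => s + c) (g := lam) h.continuousAt (by fun_prop),
    ContMDiffAt.comp t (g := fun s => (lam s).proj) (f := fun s : ℝ => s + c) h.contMDiffAt hadd,
    h.mem, h.mem_L, ?_⟩
  have hd : mfderiv 𝓘(ℝ, ℝ) (𝓡 m) (fun s => (lam (s + c)).proj) t (1 : ℝ) =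
      mfderiv 𝓘(ℝ, ℝ) (𝓡 m) (fun s => (lam s).proj) (t + c) (1 : ℝ) := by
    have h1 : mfderiv 𝓘(ℝ, ℝ) (𝓡 m) ((fun s => (lam s).proj) ∘ fun s : ℝ => s + c) t =
        (mfderiv 𝓘(ℝ, ℝ) (𝓡 m) (fun s => (lam s).proj) (t + c)).comp
          (mfderiv 𝓘(ℝ, ℝ) 𝓘(ℝ, ℝ) (fun s : ℝ => s + c) t) :=
      mfderiv_comp t (h.contMDiffAt.mdifferentiableAt (by simp))
        (hadd.mdifferentiableAt (by simp))
    have h2 : mfderiv 𝓘(ℝ, ℝ) 𝓘(ℝ, ℝ) (fun s : ℝ => s + c) t = ContinuousLinearMap.id ℝ ℝ := by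
      rw [mfderiv_eq_fderiv]
      exact ((hasFDerivAt_id t).add_const c).fderiv
    rw [h2] at h1
    exact congrArg (fun A : ℝ →L[ℝ] EuclideanSpace ℝ (Fin m) => A 1) h1
  exact hd ▸ h.sub_mem_K

variable (S)

/-- `z` and `z'` are joined in `V` by a smooth curve tangent to `E` which is constant outside a
compact interval and the `L`-component of whose velocity is continuous. -/
def SmoothlyJoinedIn (V : Set M) (z z' : M) : Prop :=
  ∃ (lam : ℝ → TangentBundle (𝓡 m) M) (a b : ℝ), a < b ∧ (∀ t, S.IsLiftAt V lam t) ∧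
    (∀ t ≤ a, lam t = ⟨z, 0⟩) ∧ ∀ t, b ≤ t → lam t = ⟨z', 0⟩

variable {S}

/-- Both curves rest at `y` around the gluing time, so no corner appears and the `L`-component stays
continuous. -/
theorem SmoothlyJoinedIn.trans {V : Set M} {x y z : M} (h₁ : S.SmoothlyJoinedIn V x y)
    (h₂ : S.SmoothlyJoinedIn V y z) : S.SmoothlyJoinedIn V x z := by
  obtain ⟨lam, a, b, hab, hlam, hx, hy⟩ := h₁
  obtain ⟨mu, c, d, hcd, hmu, hy', hz⟩ := h₂
  -- The second curve is shifted to leave `y` at time `b + 2`. Between `b` and `b + 2` both curves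
  -- equal `⟨y, 0⟩`, so the switch at `b + 1` is invisible.
  refine ⟨fun t => if t ≤ b + 1 then lam t else mu (t + (c - (b + 2))), a, d - (c - (b + 2)),
    by linarith, fun t => ?_, fun t ht => ?_, fun t ht => ?_⟩
  · rcases lt_or_ge t (b + 1) with ht | ht
    · refine (hlam t).congr ?_
      filter_upwards [Iio_mem_nhds ht] with s hs
      exact if_pos (le_of_lt hs)
    · refine (hmu (t + (c - (b + 2)))).comp_add.congr ?_
      filter_upwards [Ioi_mem_nhds (show b < t by linarith)] with s hs
      have hs' : b < s := hs
      by_cases hsb : s ≤ b + 1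
      · rw [if_pos hsb, hy s hs'.le, hy' _ (by linarith)]
      · rw [if_neg hsb]
  · change ite _ _ _ = _
    rw [if_pos (by linarith), hx t ht]
  · change ite _ _ _ = _
    rw [if_neg (by linarith), hz _ (by linarith)]

theorem velocity_eq_zero_of_eventuallyEq_const {γ : ℝ → M} {t : ℝ} {z : M}
    (h : γ =ᶠ[𝓝 t] fun _ => z) : mfderiv 𝓘(ℝ, ℝ) (𝓡 m) γ t (1 : ℝ) = 0 := by
  have h1 : HasMFDerivAt 𝓘(ℝ, ℝ) (𝓡 m) γ t
      (0 : TangentSpace 𝓘(ℝ, ℝ) t →L[ℝ] TangentSpace (𝓡 m) z) :=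
    (hasMFDerivAt_const z t).congr_of_eventuallyEq h
  rw [h1.mfderiv]
  rfl

/-- Smooth curves tangent to `L` or to `K` join their end points. -/
theorem smoothlyJoinedIn_of_curve {V : Set M} {γ : ℝ → M} (hγ : ContMDiff 𝓘(ℝ, ℝ) (𝓡 m) ∞ γ)
    (hV : ∀ t, γ t ∈ V) {x y : M} (hx : ∀ t ≤ 0, γ t = x) (hy : ∀ t, 1 ≤ t → γ t = y)
    (h : (∀ t, mfderiv 𝓘(ℝ, ℝ) (𝓡 m) γ t (1 : ℝ) ∈ S.L.fiber (γ t)) ∨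
      ∀ t, mfderiv 𝓘(ℝ, ℝ) (𝓡 m) γ t (1 : ℝ) ∈ S.K.fiber (γ t)) :
    S.SmoothlyJoinedIn V x y := by
  rcases h with h | h
  · have aux : ∀ t z, γ =ᶠ[𝓝 t] (fun _ => z) →
        velocityCurve (m := m) γ t = (⟨z, 0⟩ : TangentBundle (𝓡 m) M) := by
      intro t z hz
      have h1 := velocity_eq_zero_of_eventuallyEq_const (m := m) hz
      rw [velocityCurve, h1]
      rw [hz.self_of_nhds]
    -- A curve tangent to `L` is its own lift. The interval is widened to `[-1, 2]` so that `γ` is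
    -- constant near each time `t ≤ -1` or `t ≥ 2`, where its velocity must vanish.
    refine ⟨velocityCurve γ, -1, 2, by norm_num, fun t =>
      ⟨(continuous_velocityCurve hγ).continuousAt, hγ.contMDiffAt, hV t, h t, ?_⟩, fun t ht => aux t x ?_, fun t ht => aux t y ?_⟩
    · change mfderiv 𝓘(ℝ, ℝ) (𝓡 m) γ t (1 : ℝ) - mfderiv 𝓘(ℝ, ℝ) (𝓡 m) γ t (1 : ℝ) ∈ _
      rw [sub_self]
      exact zero_mem _
    · filter_upwards [Iio_mem_nhds (show t < 0 by linarith)] with s hs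
      exact hx s (le_of_lt hs)
    · filter_upwards [Ioi_mem_nhds (show 1 < t by linarith)] with s hs
      exact hy s (le_of_lt hs)
  -- For a curve tangent to `K` the `L`-component is zero, and the lift is the zero section along
  -- `γ`.
  · refine ⟨fun t => ⟨γ t, 0⟩, 0, 1, by norm_num, fun t => ⟨?_, hγ.contMDiffAt, hV t,
      zero_mem _, ?_⟩, fun t ht => congrArg (fun z => (⟨z, 0⟩ : TangentBundle (𝓡 m) M)) (hx t ht),
      fun t ht => congrArg (fun z => (⟨z, 0⟩ : TangentBundle (𝓡 m) M)) (hy t ht)⟩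
    · exact ((contMDiff_zeroSection ℝ (TangentSpace (𝓡 m) : M → Type _) (IB := 𝓡 m) (n := ∞)
        (F := EuclideanSpace ℝ (Fin m))).continuous.comp hγ.continuous).continuousAt
    · change mfderiv 𝓘(ℝ, ℝ) (𝓡 m) γ t (1 : ℝ) - 0 ∈ _
      rw [sub_zero]
      exact h t

theorem SmoothlyJoinedIn.refl {V : Set M} {x : M} (hx : x ∈ V) : S.SmoothlyJoinedIn V x x := by
  refine smoothlyJoinedIn_of_curve (γ := fun _ => x) contMDiff_const (fun _ => hx)
    (fun _ _ => rfl) (fun _ _ => rfl) (Or.inl fun t => ?_)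
  rw [velocity_eq_zero_of_eventuallyEq_const (Eventually.of_forall fun _ => rfl)]
  exact zero_mem _

variable {n : ℕ} {N : Type*} [TopologicalSpace N] [ChartedSpace (EuclideanSpace ℝ (Fin n)) N]
  [IsManifold (𝓡 n) ∞ N]

section Lift

variable {V : Set M} {lam : ℝ → TangentBundle (𝓡 m) M}

theorem contMDiff_of_isLiftAt (h : ∀ t, S.IsLiftAt V lam t) :
    ContMDiff 𝓘(ℝ, ℝ) (𝓡 m) ∞ fun s => (lam s).proj := fun t => (h t).contMDiffAt

theorem velocity_mem_E (h : ∀ t, S.IsLiftAt V lam t) (t : ℝ) :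
    mfderiv 𝓘(ℝ, ℝ) (𝓡 m) (fun s => (lam s).proj) t (1 : ℝ) ∈ S.E.fiber (lam t).proj := by
  rw [← S.sup_eq]
  exact Submodule.mem_sup.2 ⟨_, (h t).mem_L, _, (h t).sub_mem_K, add_sub_cancel _ _⟩

end Lift

theorem SmoothlyJoinedIn.joinedIn_E {V : Set M} {x y : M} (h : S.SmoothlyJoinedIn V x y) :
    S.E.controlSystem.JoinedIn V x y := by
  obtain ⟨lam, a, b, hab, hlam, hx, hy⟩ := h
  have hγ := contMDiff_of_isLiftAt hlam
  let c : ℝ → S.E.Total := fun t => ⟨(lam t).proj, ⟨_, velocity_mem_E hlam t⟩⟩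
  have hc : Continuous c := S.E.continuous_of_continuous_incl (continuous_velocityCurve hγ)
  refine ⟨a, b, fun t => (lam t).proj, hab, ⟨c, S.E.controlSystem.isAdmissible_of_continuous hc
    hγ (fun t => rfl) a b, fun t _ => rfl⟩, fun t _ => (hlam t).mem, ?_, ?_⟩
  · simp only [hx a le_rfl]
  · simp only [hy b le_rfl]

/-- A control of `D` along a smooth curve `γ` which has the same projection as the velocity of `γ`
gives a trajectory of the quotient. -/
theorem joinedIn_quotient_of_lift (D : TangentDistribution m M) {pr : M → N}
    (hpr : IsFibration (𝓡 m) (𝓡 n) pr)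
    (hcomp : IsFibration ((𝓡 m).prod (𝓡 D.rank)) (𝓡 n) (pr ∘ D.controlSystem.proj))
    {V : Set N} {c : ℝ → D.Total} (hc : Continuous c)
    (hγ : ContMDiff 𝓘(ℝ, ℝ) (𝓡 m) ∞ fun s => (c s).proj)
    (hd : ∀ t, mfderiv (𝓡 m) (𝓡 n) pr (c t).proj
      (mfderiv 𝓘(ℝ, ℝ) (𝓡 m) (fun s => (c s).proj) t (1 : ℝ)) =
        mfderiv (𝓡 m) (𝓡 n) pr (c t).proj (c t).snd)
    {a b : ℝ} (hab : a < b) (hV : ∀ t, pr (c t).proj ∈ V) :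
    (D.controlSystem.quotient pr hpr hcomp).JoinedIn V (pr (c a).proj) (pr (c b).proj) := by
  refine ⟨a, b, fun t => pr (c t).proj, hab, ⟨c, ControlSystem.isAdmissible_of_continuous _ hc
    (hpr.contMDiff.comp hγ) (fun t => ?_) a b, fun t _ => rfl⟩, fun t _ => hV t, rfl, rfl⟩
  have h1 : mfderiv 𝓘(ℝ, ℝ) (𝓡 n) (pr ∘ fun s => (c s).proj) t =
      (mfderiv (𝓡 m) (𝓡 n) pr (c t).proj).comp
        (mfderiv 𝓘(ℝ, ℝ) (𝓡 m) (fun s => (c s).proj) t) :=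
    mfderiv_comp t (hpr.contMDiff.contMDiffAt.mdifferentiableAt (by simp))
      (hγ.contMDiffAt.mdifferentiableAt (by simp))
  have h2 := congrArg (fun A : ℝ →L[ℝ] EuclideanSpace ℝ (Fin n) => A 1) h1
  exact h2.trans (hd t)

theorem SmoothlyJoinedIn.joinedIn_quotient_E {pr : M → N} (hpr : IsFibration (𝓡 m) (𝓡 n) pr)
    (hcomp : IsFibration ((𝓡 m).prod (𝓡 S.E.rank)) (𝓡 n) (pr ∘ S.E.controlSystem.proj))
    {V : Set N} {x y : M} (h : S.SmoothlyJoinedIn (pr ⁻¹' V) x y) :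
    (S.E.controlSystem.quotient pr hpr hcomp).JoinedIn V (pr x) (pr y) := by
  obtain ⟨lam, a, b, hab, hlam, hx, hy⟩ := h
  have hγ := contMDiff_of_isLiftAt hlam
  let c : ℝ → S.E.Total := fun t => ⟨(lam t).proj, ⟨_, velocity_mem_E hlam t⟩⟩
  have hc : Continuous c := S.E.continuous_of_continuous_incl (continuous_velocityCurve hγ)
  have := joinedIn_quotient_of_lift S.E hpr hcomp hc hγ (fun t => rfl) hab
    (fun t => (hlam t).mem)
  change ControlSystem.JoinedIn _ V (pr (lam a).proj) (pr (lam b).proj) at this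
  rwa [hx a le_rfl, hy b le_rfl] at this

/-- The differential of `pr` kills `K`, so the velocity of the curve and its `L`-component have the
same image. Motion along `K` upstairs is thus free: it changes the control without moving the
projected point. -/
theorem SmoothlyJoinedIn.joinedIn_quotient_L {pr : M → N} (hpr : IsFibration (𝓡 m) (𝓡 n) pr)
    (hker : ∀ z, (mfderiv (𝓡 m) (𝓡 n) pr z).ker = S.K.fiber z)
    (hcomp : IsFibration ((𝓡 m).prod (𝓡 S.L.rank)) (𝓡 n) (pr ∘ S.L.controlSystem.proj))
    {V : Set N} {x y : M} (h : S.SmoothlyJoinedIn (pr ⁻¹' V) x y) :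
    (S.L.controlSystem.quotient pr hpr hcomp).JoinedIn V (pr x) (pr y) := by
  obtain ⟨lam, a, b, hab, hlam, hx, hy⟩ := h
  have hγ := contMDiff_of_isLiftAt hlam
  let c : ℝ → S.L.Total := fun t => ⟨(lam t).proj, ⟨(lam t).snd, (hlam t).mem_L⟩⟩
  have hc : Continuous c := S.L.continuous_of_continuous_incl
    (continuous_iff_continuousAt.2 fun t => (hlam t).continuousAt)
  have := joinedIn_quotient_of_lift S.L hpr hcomp hc hγ (fun t => ?_) hab
    (fun t => (hlam t).mem)
  · change ControlSystem.JoinedIn _ V (pr (lam a).proj) (pr (lam b).proj) at this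
    rwa [hx a le_rfl, hy b le_rfl] at this
  · have hk := (hlam t).sub_mem_K
    rw [← hker] at hk
    have hk' : mfderiv (𝓡 m) (𝓡 n) pr (lam t).proj (_ - _) = 0 := hk
    rw [map_sub, sub_eq_zero] at hk'
    exact hk'

end PseudoProductStructure

end Trajectories

/-! ### Chains along the two foliations and local controllability -/

section LocalControllability

variable {m : ℕ} {M : Type*} [TopologicalSpace M]
  [ChartedSpace (EuclideanSpace ℝ (Fin m)) M] [IsManifold (𝓡 m) ∞ M]

namespace PseudoProductStructure

/-- The pseudo-product structure with the two factors exchanged. -/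
def swap (S : PseudoProductStructure m M) : PseudoProductStructure m M where
  E := S.E
  L := S.K
  K := S.L
  sup_eq z := by rw [sup_comm, S.sup_eq]
  disjoint z := (S.disjoint z).symm
  integrable_L := S.integrable_K
  integrable_K := S.integrable_L

variable (S : PseudoProductStructure m M)

/-- Close points of a common leaf of one of the two foliations are smoothly joined. -/
theorem eventually_smoothlyJoinedIn {D : TangentDistribution m M} (hD : D = S.L ∨ D = S.K)
    {z₀ : M} {V : Set M} (hV : IsOpen V) (hz₀ : z₀ ∈ V) {q : ℕ}
    {O : Set (EuclideanSpace ℝ (Fin m))} {f : EuclideanSpace ℝ (Fin m) → EuclideanSpace ℝ (Fin q)}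
    (hO : IsOpen O) (hO₀ : extChartAt (𝓡 m) z₀ z₀ ∈ O)
    (hf : ∀ ξ ∈ O, ContDiffAt ℝ ∞ f ξ ∧ Function.Surjective (fderiv ℝ f ξ) ∧
      ∀ v, fderiv ℝ f ξ v = 0 ↔ v ∈ D.coord z₀ ξ) :
    ∀ᶠ p in 𝓝 (extChartAt (𝓡 m) z₀ z₀, extChartAt (𝓡 m) z₀ z₀), f p.1 = f p.2 →
      S.SmoothlyJoinedIn V (chartInv z₀ p.1) (chartInv z₀ p.2) := by
  have hU : O ∩ ((extChartAt (𝓡 m) z₀).target ∩ chartInv z₀ ⁻¹' V) ∈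
      𝓝 (extChartAt (𝓡 m) z₀ z₀) := by
    refine (hO.inter ((continuousOn_extChartAt_symm z₀).isOpen_inter_preimage
      (isOpen_extChartAt_target z₀) hV)).mem_nhds ⟨hO₀, mem_extChartAt_target z₀, ?_⟩
    rwa [mem_preimage, extChartAt_to_inv]
  have hsm : ∀ᶠ ξ in 𝓝 (extChartAt (𝓡 m) z₀ z₀), ContDiffAt ℝ ∞ f ξ := by
    filter_upwards [hO.mem_nhds hO₀] with ξ hξ using (hf ξ hξ).1
  filter_upwards [exists_fibre_paths hsm (hf _ hO₀).2.1 hU] with p hp hfp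
  obtain ⟨γ, hγ, h0, h1, hγU, hγf⟩ := hp hfp
  have hγM : ContMDiff 𝓘(ℝ, ℝ) (𝓡 m) ∞ fun t => chartInv z₀ (γ t) := fun t =>
    (contMDiffAt_chartInv (hγU t).2.1).comp t (g := chartInv z₀) (f := γ)
      hγ.contMDiff.contMDiffAt
  have hmem : ∀ t, mfderiv 𝓘(ℝ, ℝ) (𝓡 m) (fun t => chartInv z₀ (γ t)) t (1 : ℝ) ∈
      D.fiber (chartInv z₀ (γ t)) := by
    intro t
    have hγt : ContDiffAt ℝ ∞ γ t := hγ.contDiffAt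
    have hder : mfderiv 𝓘(ℝ, ℝ) (𝓡 m) (chartInv z₀ ∘ γ) t =
        (chartInvDeriv z₀ (γ t)).comp (mfderiv 𝓘(ℝ, ℝ) (𝓡 m) γ t) :=
      mfderiv_comp t ((contMDiffAt_chartInv (hγU t).2.1).mdifferentiableAt (by simp))
        (hγ.contMDiff.contMDiffAt.mdifferentiableAt (by simp))
    rw [mfderiv_eq_fderiv] at hder
    have hder' : mfderiv 𝓘(ℝ, ℝ) (𝓡 m) (fun t => chartInv z₀ (γ t)) t (1 : ℝ) =
        chartInvDeriv z₀ (γ t) (fderiv ℝ γ t 1) :=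
      congrArg (fun A : ℝ →L[ℝ] EuclideanSpace ℝ (Fin m) => A 1) hder
    rw [hder', ← TangentDistribution.mem_coord, ← (hf _ (hγU t).1).2.2]
    -- Since `f` is constant along `γ`, the velocity lies in the kernel of the differential of `f`,
    -- which is `D` in coordinates.
    have hcomp : HasFDerivAt (f ∘ γ) ((fderiv ℝ f (γ t)).comp (fderiv ℝ γ t)) t :=
      ((hf _ (hγU t).1).1.differentiableAt (by simp)).hasFDerivAt.comp t
        (hγt.differentiableAt (by simp)).hasFDerivAt
    have hconst : HasFDerivAt (f ∘ γ) (0 : ℝ →L[ℝ] EuclideanSpace ℝ (Fin q)) t := by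
      rw [show f ∘ γ = fun _ => f p.1 from funext hγf]
      exact hasFDerivAt_const _ _
    exact congrArg (fun A : ℝ →L[ℝ] EuclideanSpace ℝ (Fin q) => A 1) (hcomp.unique hconst)
  refine smoothlyJoinedIn_of_curve hγM (fun t => (hγU t).2.2)
    (fun t ht => by rw [h0 t ht]) (fun t ht => by rw [h1 t ht]) ?_
  rcases hD with rfl | rfl
  · exact Or.inl hmem
  · exact Or.inr hmem

/-- The geometric core: the local Chow theorem is applied to the relation generated by steps along
level sets of the two submersions, and all three claims follow from it. -/
theorem exists_isOpen_smoothlyJoinedIn {z₀ : M} (hS : S.E.IsBracketGeneratingNear z₀) {V : Set M}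
    (hV : IsOpen V) (hz₀ : z₀ ∈ V) :
    ∃ W : Set M, IsOpen W ∧ z₀ ∈ W ∧ W ⊆ V ∧
      ∀ z₁ ∈ W, ∀ z₂ ∈ W, S.SmoothlyJoinedIn V z₁ z₂ := by
  obtain ⟨OL, qL, fL, hOL, hOL₀, hOLt, hfL⟩ := S.integrable_L.coord z₀
  obtain ⟨OK, qK, fK, hOK, hOK₀, hOKt, hfK⟩ := S.integrable_K.coord z₀
  set ξ₀ := extChartAt (𝓡 m) z₀ z₀ with hξ₀
  have hinv₀ : chartInv z₀ ξ₀ = z₀ := extChartAt_to_inv z₀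
  have hcont : ContinuousAt (chartInv z₀) ξ₀ :=
    (contMDiffAt_chartInv (mem_extChartAt_target z₀)).continuousAt
  have hbr : ∀ᶠ ξ in 𝓝 ξ₀, S.E.IsBracketGeneratingAt (chartInv z₀ ξ) :=
    hcont.eventually (by rw [hinv₀]; exact hS)
  have hVξ : ∀ᶠ ξ in 𝓝 ξ₀, chartInv z₀ ξ ∈ V :=
    hcont.eventually (hV.mem_nhds (by rwa [hinv₀]))
  have hjoin := (S.eventually_smoothlyJoinedIn (Or.inl rfl) hV hz₀ hOL hOL₀ hfL).and
    (S.eventually_smoothlyJoinedIn (Or.inr rfl) hV hz₀ hOK hOK₀ hfK)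
  obtain ⟨O₁, hO₁, hO₁₀, hO₁O₁⟩ : ∃ O₁ : Set (EuclideanSpace ℝ (Fin m)), IsOpen O₁ ∧ ξ₀ ∈ O₁ ∧
      ∀ ξ ∈ O₁, ∀ ξ' ∈ O₁,
        (fL ξ = fL ξ' → S.SmoothlyJoinedIn V (chartInv z₀ ξ) (chartInv z₀ ξ')) ∧
        (fK ξ = fK ξ' → S.SmoothlyJoinedIn V (chartInv z₀ ξ) (chartInv z₀ ξ')) := by
    obtain ⟨u, hu, hu₀, hsub⟩ := exists_nhds_square hjoin
    exact ⟨u, hu, hu₀, fun ξ hξ ξ' hξ' => hsub (mk_mem_prod hξ hξ')⟩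
  obtain ⟨O₂, hO₂sub, hO₂, hO₂₀⟩ := eventually_nhds_iff.1 (hbr.and hVξ)
  set O := O₁ ∩ O₂ ∩ (OL ∩ OK) with hOdef
  have hO : IsOpen O := (hO₁.inter hO₂).inter (hOL.inter hOK)
  have hO₀ : ξ₀ ∈ O := ⟨⟨hO₁₀, hO₂₀⟩, hOL₀, hOK₀⟩
  -- Only the end points of a step are kept in `O`; the curve realising it is allowed to roam in
  -- `V`, which is all that the conclusion needs.
  let step : EuclideanSpace ℝ (Fin m) → EuclideanSpace ℝ (Fin m) → Prop := fun ξ ξ' =>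
    ξ ∈ O ∧ ξ' ∈ O ∧ (fL ξ = fL ξ' ∨ fK ξ = fK ξ')
  have hsymm : Std.Symm step :=
    ⟨fun ξ ξ' h => ⟨h.2.1, h.1, h.2.2.imp Eq.symm Eq.symm⟩⟩
  let r := Relation.ReflTransGen step
  have hr : Equivalence r :=
    ⟨fun _ => .refl, fun h => (Relation.ReflTransGen.stdSymm (r := step)).symm _ _ h,
      fun h h' => h.trans h'⟩
  have hstep_joined : ∀ ξ ξ', step ξ ξ' →
      S.SmoothlyJoinedIn V (chartInv z₀ ξ) (chartInv z₀ ξ') := by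
    rintro ξ ξ' ⟨hξ, hξ', h | h⟩
    · exact (hO₁O₁ ξ hξ.1.1 ξ' hξ'.1.1).1 h
    · exact (hO₁O₁ ξ hξ.1.1 ξ' hξ'.1.1).2 h
  have hjoined : ∀ ξ ∈ O, ∀ ξ', r ξ ξ' →
      S.SmoothlyJoinedIn V (chartInv z₀ ξ) (chartInv z₀ ξ') := by
    intro ξ hξ ξ' h
    induction h with
    | refl => exact .refl (hO₂sub ξ hξ.1.2).2
    | tail _ h ih => exact ih.trans (hstep_joined _ _ h)
  have hnear : ∀ ξ ∈ O, ∀ᶠ p in 𝓝 (ξ, ξ), p.1 ∈ O ∧ p.2 ∈ O := fun ξ hξ =>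
    (hO.prod hO).mem_nhds (mk_mem_prod hξ hξ)
  have hsmL : ∀ ξ ∈ O, ∀ᶠ y in 𝓝 ξ, ContDiffAt ℝ ∞ fL y := fun ξ hξ => by
    filter_upwards [hO.mem_nhds hξ] with y hy using (hfL y hy.2.1).1
  have hsmK : ∀ ξ ∈ O, ∀ᶠ y in 𝓝 ξ, ContDiffAt ℝ ∞ fK y := fun ξ hξ => by
    filter_upwards [hO.mem_nhds hξ] with y hy using (hfK y hy.2.2).1
  have hmove : ∀ ξ ∈ O, S.E.coord z₀ ξ ≤ Submodule.span ℝ {v | IsMoveVector r ξ v} := by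
    intro ξ hξ
    refine (S.coord_E_le (hOLt hξ.2.1)).trans (sup_le (fun v hv => ?_) (fun v hv => ?_))
    · refine Submodule.subset_span (isMoveVector_of_mem_ker (hsmL ξ hξ) (hfL ξ hξ.2.1).2.1
        (((hfL ξ hξ.2.1).2.2 v).2 hv) ?_)
      filter_upwards [hnear ξ hξ] with p hp h using .single ⟨hp.1, hp.2, Or.inl h⟩
    · refine Submodule.subset_span (isMoveVector_of_mem_ker (hsmK ξ hξ) (hfK ξ hξ.2.2).2.1
        (((hfK ξ hξ.2.2).2.2 v).2 hv) ?_)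
      filter_upwards [hnear ξ hξ] with p hp h using .single ⟨hp.1, hp.2, Or.inr h⟩
  -- A submersion is open at `ξ'`, so the level sets through points near `ξ` all meet a given
  -- neighbourhood of `ξ'`.
  have htrans_step : ∀ ξ ξ', step ξ ξ' → ∀ n ∈ 𝓝 ξ', ∀ᶠ x in 𝓝 ξ, ∃ y ∈ n, step x y := by
    rintro ξ ξ' ⟨hξ, hξ', h⟩ n hn
    have aux : ∀ {q : ℕ} (f : EuclideanSpace ℝ (Fin m) → EuclideanSpace ℝ (Fin q)),
        ContDiffAt ℝ ∞ f ξ → ContDiffAt ℝ ∞ f ξ' → Function.Surjective (fderiv ℝ f ξ') →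
        f ξ = f ξ' → ∀ᶠ x in 𝓝 ξ, ∃ y ∈ n ∩ O, f x = f y := by
      intro q f h1 h2 hs hff
      have hopen : map f (𝓝 ξ') = 𝓝 (f ξ') :=
        (h2.hasStrictFDerivAt (by simp)).map_nhds_eq_of_surj (LinearMap.range_eq_top.2 hs)
      have himg : f '' (n ∩ O) ∈ 𝓝 (f ξ) := by
        rw [hff, ← hopen]
        exact image_mem_map (inter_mem hn (hO.mem_nhds hξ'))
      filter_upwards [h1.continuousAt.preimage_mem_nhds himg] with x hx
      obtain ⟨y, hy, hxy⟩ := hx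
      exact ⟨y, hy, hxy.symm⟩
    rcases h with h | h
    · filter_upwards [aux fL (hfL _ hξ.2.1).1 (hfL _ hξ'.2.1).1 (hfL _ hξ'.2.1).2.1 h,
        hO.mem_nhds hξ] with x ⟨y, hy, hxy⟩ hx
      exact ⟨y, hy.1, hx, hy.2, Or.inl hxy⟩
    · filter_upwards [aux fK (hfK _ hξ.2.2).1 (hfK _ hξ'.2.2).1 (hfK _ hξ'.2.2).2.1 h,
        hO.mem_nhds hξ] with x ⟨y, hy, hxy⟩ hx
      exact ⟨y, hy.1, hx, hy.2, Or.inr hxy⟩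
  have htrans : ∀ ξ ξ', r ξ ξ' → ∀ n ∈ 𝓝 ξ', ∀ᶠ x in 𝓝 ξ, ∃ y ∈ n, r x y := by
    intro ξ ξ' h n hn
    -- Working from the far end, the points from which `n` can be reached form a neighbourhood of
    -- the next point of the chain; this set is the target for the first step.
    induction h using Relation.ReflTransGen.head_induction_on with
    | refl => filter_upwards [hn] with x hx using ⟨x, hx, .refl⟩
    | head h _ ih =>
      filter_upwards [htrans_step _ _ h _ ih] with x ⟨y, ⟨w, hw, hyw⟩, hxy⟩
      exact ⟨w, hw, .head hxy hyw⟩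
  have hclass : ∀ᶠ ξ in 𝓝 ξ₀, r ξ₀ ξ :=
    eventually_rel_of_bracketGenerating hr hO hO₀ hmove
      (fun ξ _ ξ' _ => htrans ξ ξ') fun ξ hξ =>
      (hO₂sub ξ hξ.1.2).1.coord (hOLt hξ.2.1)
  obtain ⟨G, hGsub, hG, hG₀⟩ := eventually_nhds_iff.1
    (hclass.and (eventually_mem_set.2 (hO.mem_nhds hO₀)))
  refine ⟨(extChartAt (𝓡 m) z₀).source ∩ extChartAt (𝓡 m) z₀ ⁻¹' G,
    (continuousOn_extChartAt z₀).isOpen_inter_preimage (isOpen_extChartAt_source z₀) hG,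
    ⟨mem_extChartAt_source z₀, hG₀⟩, ?_, ?_⟩
  · rintro z ⟨hz, hzG⟩
    have := (hO₂sub _ (hGsub _ hzG).2.1.2).2
    rwa [chartInv, (extChartAt (𝓡 m) z₀).left_inv hz] at this
  · rintro z₁ ⟨hz₁, hz₁G⟩ z₂ ⟨hz₂, hz₂G⟩
    -- Both points lie in the class of `ξ₀`, so they are joined by a chain through `ξ₀`.
    have := hjoined _ (hGsub _ hz₁G).2 _ (hr.trans (hr.symm (hGsub _ hz₁G).1) (hGsub _ hz₂G).1)
    rwa [chartInv, (extChartAt (𝓡 m) z₀).left_inv hz₁,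
      (extChartAt (𝓡 m) z₀).left_inv hz₂] at this

end PseudoProductStructure

/-- Fibrations are open maps. -/
theorem IsFibration.isOpenMap {n : ℕ} {N : Type*} [TopologicalSpace N]
    [ChartedSpace (EuclideanSpace ℝ (Fin n)) N] {pr : M → N} (h : IsFibration (𝓡 m) (𝓡 n) pr) :
    IsOpenMap pr := by
  refine isOpenMap_iff_nhds_le.2 fun z => ?_
  obtain ⟨_, F, _, _, _, e, he, -⟩ := h.locallyTrivial (pr z)
  exact (e.map_proj_nhds (e.mem_source.2 he)).ge

/-- Joining takes place upstairs in `pr ⁻¹' V`; the neighbourhood found there has open image because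
fibrations are open maps. -/
theorem locallyControllableAt_of_joined {n : ℕ} {N : Type*} [TopologicalSpace N]
    [ChartedSpace (EuclideanSpace ℝ (Fin n)) N] [IsManifold (𝓡 n) ∞ N]
    {EU HU U : Type*} [NormedAddCommGroup EU] [NormedSpace ℝ EU] [TopologicalSpace HU]
    [TopologicalSpace U] [ChartedSpace HU U] {IU : ModelWithCorners ℝ EU HU}
    (C : ControlSystem IU U (𝓡 n) N) {pr : M → N} (hpr : IsFibration (𝓡 m) (𝓡 n) pr)
    (S : PseudoProductStructure m M) {z₀ : M} (hS : S.E.IsBracketGeneratingNear z₀)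
    (hC : ∀ (V : Set N) (x y : M), S.SmoothlyJoinedIn (pr ⁻¹' V) x y → C.JoinedIn V (pr x) (pr y)) :
    C.LocallyControllableAt (pr z₀) := by
  intro V hV hz₀
  obtain ⟨W, hW, hzW, hWV, hjoin⟩ := S.exists_isOpen_smoothlyJoinedIn hS
    (hV.preimage hpr.contMDiff.continuous) hz₀
  refine ⟨pr '' W, hpr.isOpenMap W hW, mem_image_of_mem pr hzW, image_subset_iff.2 hWV, ?_⟩
  rintro _ ⟨z₁, hz₁, rfl⟩ _ ⟨z₂, hz₂, rfl⟩
  exact hC V z₁ z₂ (hjoin z₁ hz₁ z₂ hz₂)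

end LocalControllability

end

end PseudoProduct

open Bundle PseudoProduct
open scoped Manifold ContDiff

theorem lemma5p2 {m n p : ℕ} {M N P : Type*}
    [TopologicalSpace M] [T2Space M] [SecondCountableTopology M]
    [ChartedSpace (EuclideanSpace ℝ (Fin m)) M] [IsManifold (𝓡 m) ∞ M]
    [TopologicalSpace N] [T2Space N] [SecondCountableTopology N]
    [ChartedSpace (EuclideanSpace ℝ (Fin n)) N] [IsManifold (𝓡 n) ∞ N]
    [TopologicalSpace P] [T2Space P] [SecondCountableTopology P]
    [ChartedSpace (EuclideanSpace ℝ (Fin p)) P] [IsManifold (𝓡 p) ∞ P]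
    (S : PseudoProductStructure m M) (z₀ : M) (hS : S.E.IsBracketGeneratingNear z₀) :
    S.E.controlSystem.LocallyControllableAt z₀ ∧
    (∀ (πN : M → N) (hπN : IsFibration (𝓡 m) (𝓡 n) πN),
      (∀ z, (mfderiv (𝓡 m) (𝓡 n) πN z).ker = S.K.fiber z) →
      (∀ hEN : IsFibration ((𝓡 m).prod (𝓡 S.E.rank)) (𝓡 n) (πN ∘ S.E.controlSystem.proj),
        (S.E.controlSystem.quotient πN hπN hEN).LocallyControllableAt (πN z₀)) ∧
      (∀ hLN : IsFibration ((𝓡 m).prod (𝓡 S.L.rank)) (𝓡 n) (πN ∘ S.L.controlSystem.proj),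
        (S.L.controlSystem.quotient πN hπN hLN).LocallyControllableAt (πN z₀))) ∧
    (∀ (πP : M → P) (hπP : IsFibration (𝓡 m) (𝓡 p) πP),
      (∀ z, (mfderiv (𝓡 m) (𝓡 p) πP z).ker = S.L.fiber z) →
      (∀ hEP : IsFibration ((𝓡 m).prod (𝓡 S.E.rank)) (𝓡 p) (πP ∘ S.E.controlSystem.proj),
        (S.E.controlSystem.quotient πP hπP hEP).LocallyControllableAt (πP z₀)) ∧
      (∀ hKP : IsFibration ((𝓡 m).prod (𝓡 S.K.rank)) (𝓡 p) (πP ∘ S.K.controlSystem.proj),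
        (S.K.controlSystem.quotient πP hπP hKP).LocallyControllableAt (πP z₀))) := by
  refine ⟨fun V hV hz₀ => ?_, fun πN hπN hker => ⟨fun hEN => ?_, fun hLN => ?_⟩,
    fun πP hπP hker => ⟨fun hEP => ?_, fun hKP => ?_⟩⟩
  · obtain ⟨W, hW, hzW, hWV, hjoin⟩ := S.exists_isOpen_smoothlyJoinedIn hS hV hz₀
    exact ⟨W, hW, hzW, hWV, fun z₁ hz₁ z₂ hz₂ => (hjoin z₁ hz₁ z₂ hz₂).joinedIn_E⟩
  · exact locallyControllableAt_of_joined _ hπN S hS fun V x y h => h.joinedIn_quotient_E hπN hEN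
  · exact locallyControllableAt_of_joined _ hπN S hS fun V x y h =>
      h.joinedIn_quotient_L hπN hker hLN
  · exact locallyControllableAt_of_joined _ hπP S hS fun V x y h => h.joinedIn_quotient_E hπP hEP
  -- Exchanging `L` and `K` leaves `E`, hence the bracket condition, unchanged, and turns the claim
  -- on `K` into the one on `L`.
  · exact locallyControllableAt_of_joined _ hπP S.swap hS fun V x y h =>
      h.joinedIn_quotient_L (S := S.swap) hπP hker hKP
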